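/- Notation. Strings are elements of $\{0,1\}^*$; $\langle\cdot,\cdot\rangle$ is a standard pairing of strings; $\|P-Q\|=\frac12\sum_y|P(y)-Q(y)|$ is variation distance. A *search problem* is a family $R=(A_x)_{x\in\{0,1\}^*}$ of nonempty sets $A_x\subseteq\{0,1\}^{p(|x|)}$, and a *sampling problem* is a family $S=(\mathcal D_x)_{x\in\{0,1\}^*}$ of probability distributions $\mathcal D_x$ over $\{0,1\}^{p(|x|)}$, where $p$ is a polynomial. A probabilistic Turing machine $B$ (with no bound on its running time) *solves* $R$ if, for all $x$ and all integers $k\ge1$, on input $\langle x,0^k\rangle$ it halts with probability $1$ and outputs an element of $A_x$ with probability at least $1-1/k$. An oracle $\mathcal O$ (a function on strings, or more generally one whose answers are drawn afresh in each call from a distribution depending on the query) *solves* $S$ if for some polynomial $q$, for all $x$ and all integers $k\ge1$, the answer of $\mathcal O$ to the query $\langle\langle x,0^k\rangle,r\rangle$, with $r$ uniform in $\{0,1\}^{q(|\langle x,0^k\rangle|)}$, has a distribution within variation distance $1/k$ of $\mathcal D_x$. $R\in\mathsf{FBPP}^{\mathcal O}$ means that some probabilistic polynomial-time oracle Turing machine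 with oracle $\mathcal O$, given $\langle x,0^k\rangle$ with $k\ge1$, outputs an element of $A_x$ with probability at least $1-1/k$. Let $U$ be a universal prefix machine: a partial computable function $U(p,x)$ such that for each $x$ the set of $p$ with $U(p,x)$ defined is prefix-free, and such that for every other such function $V$ there is a string $w$ with $U(wp,x)=V(p,x)$ for all $p,x$. Let $\mathcal U_x(y)=\sum_{p:\,U(p,x)=y}2^{-|p|}$ be the universal prior given $x$. **Theorem.** For every search problem $R=(A_x)_x$ there is a sampling problem $S_R=(\mathcal D_x)_x$, where $\mathcal D_x$ is $\mathcal U_x$ conditioned on $A_x$, that is, $\mathcal D_x(y)=\mathcal U_x(y)/\sum_{z\in A_x}\mathcal U_x(z)$ for $y\in A_x$ and $\mathcal D_x(y)=0$ otherwise, such that: (i) if $\mathcal O$ is any oracle solving $S_R$, then $R\in\mathsf{FBPP}^{\mathcal O}$; (ii) for every probabilistic Turing machine $B$ there is a constant $\eta_B>0$, depending only on $B$ (and $U$), such that whenever $B$ solves $R$, there is a probabilistic polynomial-time oracle machine which, on input $x$ and with $B$ as a black box (each call on a string $w$ returns, in one step, a fresh sample of the output of $B$ on $w$), samples from a distribution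 $\mathcal C_x$ with $\|\mathcal C_x-\mathcal D_x\|\le1-\eta_B$, for every $x$. -/

import Mathlib

/-! ### Bit strings and encodings -/

/-- The string `0^k`. -/
def zeros (k : ℕ) : List Bool := List.replicate k false

/-- The pair `⟨x, z⟩` as one string: every bit of `x` doubled, then the mark `01`, then `z`. -/
def pairStr (x z : List Bool) : List Bool :=
  (x.flatMap fun b => [b, b]) ++ [false, true] ++ z

/-- `f` agrees with a polynomial on the natural numbers. -/
def IsPolynomial (f : ℕ → ℕ) : Prop :=
  ∃ q : Polynomial ℚ, ∀ n : ℕ, (f n : ℚ) = q.eval (n : ℚ)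

/-- A uniformly random string of `n` bits. -/
noncomputable def uniformBits (n : ℕ) : PMF (List Bool) :=
  (PMF.uniformOfFintype (List.Vector Bool n)).map Subtype.val

/-- Variation distance `½ ∑ |p_y - q_y|`. -/
noncomputable def variationDist {α : Type*} (P Q : PMF α) : ℝ :=
  (1 / 2) * ∑' a, |(P a).toReal - (Q a).toReal|

/-! ### Search problems and sampling problems -/

/-- A search problem: a nonempty set `A_x ⊆ {0,1}^{p(|x|)}` for every string `x`. -/
structure SearchProblem where
  sol : List Bool → Set (List Bool)
  len : ℕ → ℕ
  len_poly : IsPolynomial len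
  nonempty : ∀ x, (sol x).Nonempty
  length_eq : ∀ x, ∀ y ∈ sol x, y.length = len x.length

/-- A sampling problem: a distribution `D_x` over `{0,1}^{p(|x|)}` for every string `x`. -/
structure SamplingProblem where
  dist : List Bool → PMF (List Bool)
  len : ℕ → ℕ
  len_poly : IsPolynomial len
  length_eq : ∀ x, ∀ y ∈ (dist x).support, y.length = len x.length

/-! ### Probabilistic Turing machines, with and without an oracle -/

/-- A two-way infinite tape over the alphabet `{0, 1, blank}` (`none` is the blank): the symbols
left of the head, nearest first, and the symbols from the head rightwards. Cells beyond the ends of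
the lists are blank. -/
structure BitTape where
  left : List (Option Bool)
  right : List (Option Bool)

namespace BitTape

/-- The scanned symbol. -/
def read (t : BitTape) : Option Bool := t.right.headD none

/-- Overwrite the scanned cell. -/
def write (t : BitTape) (a : Option Bool) : BitTape := ⟨t.left, a :: t.right.tail⟩

/-- Move the head by one cell, or leave it (`none`). -/
def move (t : BitTape) : Option Turing.Dir → BitTape
  | none => t
  | some Turing.Dir.left => ⟨t.left.tail, t.left.headD none :: t.right⟩
  | some Turing.Dir.right => ⟨t.read :: t.left, t.right.tail⟩

/-- The tape holding `s`, with the head on its first symbol. -/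
def ofString (s : List Bool) : BitTape := ⟨[], s.map some⟩

/-- The string written on a tape: its non-blank symbols from left to right. -/
def contents (t : BitTape) : List Bool := (t.left.reverse ++ t.right).reduceOption

end BitTape

/-- A probabilistic Turing machine with finitely many tapes. In every step it reads the scanned
symbols and one fresh coin; then it changes state, writes on each tape and moves each head.
The input tape holds the input at the start, all other tapes are blank; the output is the string on
the output tape when the state `halt` is reached. -/
structure PTM where
  State : Type
  TapeIdx : Type
  [stateFintype : Fintype State]
  [stateDecEq : DecidableEq State]
  [tapeFintype : Fintype TapeIdx]
  [tapeDecEq : DecidableEq TapeIdx]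
  start : State
  halt : State
  inputTape : TapeIdx
  outputTape : TapeIdx
  trans : State → (TapeIdx → Option Bool) → Bool →
    State × (TapeIdx → Option Bool × Option Turing.Dir)

attribute [instance] PTM.stateFintype PTM.stateDecEq PTM.tapeFintype PTM.tapeDecEq

namespace PTM

/-- A configuration: the state and the tapes. -/
structure Cfg (M : PTM) where
  state : M.State
  tape : M.TapeIdx → BitTape

/-- The initial configuration on input `w`. -/
def init (M : PTM) (w : List Bool) : M.Cfg :=
  ⟨M.start, fun i => BitTape.ofString (if i = M.inputTape then w else [])⟩

/-- The configuration that follows `c` when the coin shows `b` (no halting test). -/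
def next (M : PTM) (c : M.Cfg) (b : Bool) : M.Cfg :=
  let r := M.trans c.state (fun i => (c.tape i).read) b
  ⟨r.1, fun i => ((c.tape i).write (r.2 i).1).move (r.2 i).2⟩

/-- One step with a fair coin; halted configurations stay as they are. -/
noncomputable def step (M : PTM) (c : M.Cfg) : PMF M.Cfg :=
  if c.state = M.halt then PMF.pure c else (PMF.uniformOfFintype Bool).map (M.next c)

/-- The distribution of the configuration after `t` steps on input `w`. -/
noncomputable def run (M : PTM) (w : List Bool) : ℕ → PMF M.Cfg
  | 0 => PMF.pure (M.init w)
  | t + 1 => (M.run w t).bind M.step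

/-- The string on the output tape. -/
def out (M : PTM) (c : M.Cfg) : List Bool := (c.tape M.outputTape).contents

/-- The probability that `M`, on input `w`, halts with output `y` (the limit over the number of
steps, which is increasing). There is no bound on the running time. -/
noncomputable def outProb (M : PTM) (w y : List Bool) : ENNReal :=
  ⨆ t, (M.run w t).toOuterMeasure {c | c.state = M.halt ∧ M.out c = y}

/-- `M` halts with probability one on input `w`. -/
def HaltsAlmostSurely (M : PTM) (w : List Bool) : Prop := ∑' y, M.outProb w y = 1

/-- `M` solves the search problem `R`: on input `⟨x, 0^k⟩`, where `1/k` is the allowed error, it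
halts with probability one, and its output lies in `A_x` with probability at least `1 - 1/k`. -/
def SolvesSearch (M : PTM) (R : SearchProblem) : Prop :=
  ∀ (x : List Bool) (k : ℕ), 1 ≤ k →
    M.HaltsAlmostSurely (pairStr x (zeros k)) ∧
    1 - (k : ENNReal)⁻¹ ≤ ∑' y : R.sol x, M.outProb (pairStr x (zeros k)) y

end PTM

/-- An oracle answers each query string by a string drawn from a distribution that depends on the
query, with fresh independent randomness in every call. An ordinary oracle is a function `f` from
strings to strings, seen as the oracle `fun s => PMF.pure (f s)`. -/
abbrev Oracle := List Bool → PMF (List Bool)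

/-- A probabilistic oracle Turing machine: entering the state `query` submits the string on the
oracle tape; in one step it is replaced by the answer, and the machine is in state `resume`. -/
structure OracleTM extends PTM where
  oracleTape : TapeIdx
  query : State
  resume : State

namespace OracleTM

/-- One step with oracle `O`. -/
noncomputable def oracleStep (M : OracleTM) (O : Oracle) (c : M.toPTM.Cfg) : PMF M.toPTM.Cfg :=
  if c.state = M.halt then PMF.pure c
  else if c.state = M.query then
    (O (c.tape M.oracleTape).contents).map fun a =>
      ⟨M.resume, Function.update c.tape M.oracleTape (BitTape.ofString a)⟩
  else (PMF.uniformOfFintype Bool).map (M.toPTM.next c)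

/-- The distribution of the configuration after `t` steps on input `w` with oracle `O`. -/
noncomputable def oracleRun (M : OracleTM) (O : Oracle) (w : List Bool) : ℕ → PMF M.toPTM.Cfg
  | 0 => PMF.pure (M.toPTM.init w)
  | t + 1 => (M.oracleRun O w t).bind (M.oracleStep O)

/-- On every computation path `M` halts on input `w` within `t` steps. -/
def HaltsWithin (M : OracleTM) (O : Oracle) (w : List Bool) (t : ℕ) : Prop :=
  ∀ c ∈ (M.oracleRun O w t).support, c.state = M.halt

/-- The distribution of the string on the output tape after `t` steps. -/
noncomputable def outputAt (M : OracleTM) (O : Oracle) (w : List Bool) (t : ℕ) :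
    PMF (List Bool) :=
  (M.oracleRun O w t).map M.toPTM.out

end OracleTM

/-- `R ∈ FBPP^O`: some probabilistic oracle machine, on input `⟨x, 0^k⟩`, runs in time polynomial in
the length of that input and outputs an element of `A_x` with probability at least `1 - 1/k`. -/
def InFBPP (O : Oracle) (R : SearchProblem) : Prop :=
  ∃ (M : OracleTM) (T : Polynomial ℕ), ∀ (x : List Bool) (k : ℕ), 1 ≤ k →
    M.HaltsWithin O (pairStr x (zeros k)) (T.eval (pairStr x (zeros k)).length) ∧
    1 - (k : ENNReal)⁻¹ ≤ (M.outputAt O (pairStr x (zeros k))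
      (T.eval (pairStr x (zeros k)).length)).toOuterMeasure (R.sol x)

/-- `O` solves the sampling problem `S`: for some polynomial `q`, on queries `⟨⟨x, 0^k⟩, r⟩` with a
uniformly random string `r` of `q(|⟨x, 0^k⟩|)` bits, its answer has a distribution within
variation distance `1/k` of `D_x`. -/
def SolvesSampling (O : Oracle) (S : SamplingProblem) : Prop :=
  ∃ q : Polynomial ℕ, ∀ (x : List Bool) (k : ℕ), 1 ≤ k →
    variationDist
      ((uniformBits (q.eval (pairStr x (zeros k)).length)).bind
        fun r => O (pairStr (pairStr x (zeros k)) r))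
      (S.dist x) ≤ 1 / (k : ℝ)

/-- `O` is the machine `B` used as a black box: every call on a string `w` on which `B` halts with
probability one returns a fresh sample of the output of `B` on `w`. -/
def IsSamplerFor (O : Oracle) (B : PTM) : Prop :=
  ∀ w, B.HaltsAlmostSurely w → ∀ y, O w y = B.outProb w y

/-! ### Universal prefix machines and the universal prior -/

/-- A prefix machine `V`, with program `p` and condition `x` as inputs: a partial computable
function such that, for each condition, the set of programs on which it halts is prefix-free. -/
structure IsPrefixMachine (V : List Bool → List Bool →. List Bool) : Prop where
  partrec : Partrec₂ V
  prefixFree : ∀ x p q, (V p x).Dom → (V q x).Dom → p <+: q → p = q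

/-- A universal prefix machine: it simulates every prefix machine `V`, given a description `w` of
`V` in front of the program. -/
structure IsUniversalPrefixMachine (U : List Bool → List Bool →. List Bool) : Prop
    extends IsPrefixMachine U where
  simulates : ∀ V, IsPrefixMachine V → ∃ w, ∀ p x, U (w ++ p) x = V p x

/-- The universal prior `∑ 2^{-|p|}`, over the programs `p` with `U(p, x) = y`: the probability that
`U`, with condition `x` and random program bits, outputs `y`. -/
noncomputable def universalPrior (U : List Bool → List Bool →. List Bool)
    (x y : List Bool) : ENNReal :=
  ∑' p : {p : List Bool // y ∈ U p x}, (2⁻¹ : ENNReal) ^ p.1.length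

/-- The probability of `y` under the universal prior given `x`, conditioned on the event `A`. -/
noncomputable def conditionedPrior (U : List Bool → List Bool →. List Bool)
    (x : List Bool) (A : Set (List Bool)) (y : List Bool) : ENNReal :=
  A.indicator (universalPrior U x) y / ∑' z : A, universalPrior U x z

/-! Universal prefix machines exist. -/

namespace UniversalExistence

open Nat.Partrec (Code)

/-- `t` steps of simulation of program `1^e 0 p` on condition `x`: run the `e`-th code on `(p, x)`. -/
def stage (a : List Bool × List Bool) (t : ℕ) : Option ℕ :=
  if Encodable.encode a.1 < t ∧ a.1.dropWhile id ≠ [] then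
    Code.evaln t (Denumerable.ofNat Code (a.1.takeWhile id).length)
      (Encodable.encode ((a.1.dropWhile id).tail, a.2))
  else none

theorem stage_mono {a s t n} (h : s ≤ t) (hn : stage a s = some n) : stage a t = some n := by
  unfold stage at *
  split_ifs at hn with h1
  rw [if_pos ⟨h1.1.trans_le h, h1.2⟩]
  exact Code.evaln_mono h hn

theorem stage_primrec : Primrec₂ stage := by
  unfold stage
  have e1 : Primrec fun x : (List Bool × List Bool) × ℕ => x.1.1 := Primrec.fst.comp Primrec.fst
  have d1 : Primrec fun x : (List Bool × List Bool) × ℕ => x.1.1.dropWhile id :=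
    (Primrec.list_dropWhile Primrec.id).comp e1
  refine Primrec.ite ?_ ?_ (Primrec.const none)
  · exact PrimrecPred.and (Primrec.nat_lt.comp (Primrec.encode.comp e1) Primrec.snd)
      (PrimrecPred.not (Primrec.eq.comp d1 (Primrec.const [])))
  · refine Code.primrec_evaln.comp (Primrec.pair (Primrec.pair Primrec.snd ?_) ?_)
    · exact (Primrec.ofNat Code).comp
        (Primrec.list_length.comp ((Primrec.list_takeWhile Primrec.id).comp e1))
    · exact Primrec.encode.comp
        (Primrec.pair (Primrec.list_tail.comp d1) (Primrec.snd.comp Primrec.fst))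

/-- Distinct strings one of which is a prefix of the other. -/
def compat (s q : List Bool) : Prop :=
  s ≠ q ∧ (q.take s.length = s ∨ s.take q.length = q)

instance : DecidableRel compat := fun s q => by unfold compat; infer_instance

/-- No other program comparable with `a.1` has halted by stage `t`. -/
def alone (a : List Bool × List Bool) (t : ℕ) : Prop :=
  ∀ m ∈ List.range t, ¬ (compat ((Encodable.decode m : Option (List Bool)).getD []) a.1 ∧
    stage ((Encodable.decode m : Option (List Bool)).getD [], a.2) t ≠ none)

instance (a t) : Decidable (alone a t) := by unfold alone; infer_instance

theorem alone_primrec : PrimrecRel alone := by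
  have s1 : Primrec fun x : ℕ × ((List Bool × List Bool) × ℕ) =>
      (Encodable.decode x.1 : Option (List Bool)).getD [] :=
    Primrec.option_getD.comp (Primrec.decode.comp Primrec.fst) (Primrec.const [])
  have q1 : Primrec fun x : ℕ × ((List Bool × List Bool) × ℕ) => x.2.1.1 :=
    Primrec.fst.comp (Primrec.fst.comp Primrec.snd)
  have hR : PrimrecRel fun (m : ℕ) (b : (List Bool × List Bool) × ℕ) =>
      ¬ (compat ((Encodable.decode m : Option (List Bool)).getD []) b.1.1 ∧
        stage ((Encodable.decode m : Option (List Bool)).getD [], b.1.2) b.2 ≠ none) := by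
    refine PrimrecPred.not (PrimrecPred.and (PrimrecPred.and
      (PrimrecPred.not (Primrec.eq.comp s1 q1)) (PrimrecPred.or
        (Primrec.eq.comp (Primrec.list_take.comp (Primrec.list_length.comp s1) q1) s1)
        (Primrec.eq.comp (Primrec.list_take.comp (Primrec.list_length.comp q1) s1) q1)))
      (PrimrecPred.not (Primrec.eq.comp (stage_primrec.comp (Primrec.pair s1 ?_) ?_)
        (Primrec.const none))))
    · exact Primrec.snd.comp (Primrec.fst.comp Primrec.snd)
    · exact Primrec.snd.comp Primrec.snd
  exact (hR.forall_mem_list).comp (Primrec.list_range.comp Primrec.snd) Primrec.id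

/-- Run program `q` until it halts, at stage `t` say; accept the result only if no comparable
program has halted by then. This leaves codes of prefix machines unchanged. -/
def machine (q x : List Bool) : Part (List Bool) :=
  (Nat.rfind fun t => Part.some (stage (q, x) t).isSome).bind fun t =>
    Part.ofOption (if alone (q, x) t then
      (stage (q, x) t).bind fun n => (Encodable.decode n : Option (List Bool)) else none)

theorem machine_partrec : Partrec₂ machine := by
  unfold machine
  refine Partrec.bind (Partrec.rfind ?_) ?_
  · exact (Primrec.option_isSome.comp (stage_primrec.comp (Primrec.fst) Primrec.snd)).to_comp.partrec
  · refine (Primrec.to_comp ?_).ofOption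
    refine Primrec.ite alone_primrec ?_ (Primrec.const none)
    exact Primrec.option_bind stage_primrec (Primrec.decode.comp Primrec.snd).to₂

theorem machine_dom {q x} (h : (machine q x).Dom) :
    ∃ t n, stage (q, x) t = some n ∧ alone (q, x) t := by
  obtain ⟨y, hy⟩ := Part.dom_iff_mem.1 h
  simp only [machine, Part.mem_bind_iff] at hy
  obtain ⟨t, ht, h2⟩ := hy
  have h3 := Nat.rfind_spec ht
  simp only [Part.mem_some_iff] at h3
  obtain ⟨n, hn⟩ := Option.isSome_iff_exists.1 h3.symm
  refine ⟨t, n, hn, ?_⟩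
  by_contra hc
  simp [hc] at h2

theorem not_both {x q s t u n m} (hq : stage (q, x) t = some n) (_ : stage (s, x) u = some m)
    (ha : alone (s, x) u) (htu : t ≤ u) (hc : compat q s) : False := by
  have h1 := stage_mono htu hq
  have hlt : Encodable.encode q < u := by
    unfold stage at h1
    split_ifs at h1 with h
    exact h.1
  refine ha (Encodable.encode q) (List.mem_range.2 hlt) ?_
  simp [hc, h1]

theorem compat_of_prefix {p q : List Bool} (h : p <+: q) (hne : p ≠ q) :
    compat p q ∧ compat q p :=
  ⟨⟨hne, Or.inl (List.prefix_iff_eq_take.1 h).symm⟩,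
    ⟨hne.symm, Or.inr (List.prefix_iff_eq_take.1 h).symm⟩⟩

theorem machine_isPrefix : IsPrefixMachine machine where
  partrec := machine_partrec
  prefixFree x p q hp hq hpq := by
    by_contra hne
    obtain ⟨t, n, h1, h2⟩ := machine_dom hp
    obtain ⟨u, m, h3, h4⟩ := machine_dom hq
    have hc := compat_of_prefix hpq hne
    rcases le_total t u with h | h
    · exact not_both h1 h3 h4 h hc.1
    · exact not_both h3 h1 h2 h hc.2

theorem compat_prefix {s q : List Bool} (h : compat s q) : s ≠ q ∧ (s <+: q ∨ q <+: s) :=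
  ⟨h.1, h.2.imp (fun h => List.prefix_iff_eq_take.2 h.symm)
    (fun h => List.prefix_iff_eq_take.2 h.symm)⟩

/-- The self-delimiting code `1^e 0`. -/
def header (e : ℕ) : List Bool := List.replicate e true ++ [false]

theorem header_takeWhile (e p) : ((header e ++ p).takeWhile id) = List.replicate e true := by
  induction e with
  | zero => simp [header]
  | succ e ih => simp_all [header, List.replicate_succ]

theorem header_dropWhile (e p) : ((header e ++ p).dropWhile id) = false :: p := by
  induction e with
  | zero => simp [header]
  | succ e ih => simp_all [header, List.replicate_succ]

theorem eq_header {s : List Bool} (h : s.dropWhile id ≠ []) : ∃ e p, s = header e ++ p := by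
  induction s with
  | nil => simp at h
  | cons b s ih =>
    cases b with
    | false => exact ⟨0, s, by simp [header]⟩
    | true =>
      obtain ⟨e, p, rfl⟩ := ih (by simpa using h)
      exact ⟨e + 1, p, by simp [header, List.replicate_succ]⟩

theorem header_prefix {e f : ℕ} {p q : List Bool} (h : header e ++ p <+: header f ++ q) :
    e = f ∧ p <+: q := by
  induction e generalizing f with
  | zero =>
    cases f with
    | zero => simpa [header] using h
    | succ f => simp [header, List.replicate_succ] at h
  | succ e ih =>
    cases f with
    | zero => simp [header, List.replicate_succ] at h
    | succ f =>
      have := @ih f (by simpa [header, List.replicate_succ] using h)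
      simpa using this

theorem stage_header {e p x t n} : stage (header e ++ p, x) t = some n ↔
    Encodable.encode (header e ++ p) < t ∧
      n ∈ Code.evaln t (Denumerable.ofNat Code e) (Encodable.encode (p, x)) := by
  unfold stage
  simp only [header_takeWhile, header_dropWhile, List.length_replicate, List.tail_cons]
  split_ifs with h
  · simp [h.1]
  · simp at h; simp [h]

theorem machine_isUniversal : IsUniversalPrefixMachine machine where
  toIsPrefixMachine := machine_isPrefix
  simulates V hV := by
    obtain ⟨c, hc⟩ := Code.exists_code.1 hV.partrec
    refine ⟨header (Encodable.encode c), fun p x => ?_⟩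
    have hc' : ∀ p x, Code.eval c (Encodable.encode (p, x)) = (V p x).map Encodable.encode := by
      intro p x; rw [hc]; simp
    have hst : ∀ {p t n}, stage (header (Encodable.encode c) ++ p, x) t = some n →
        n ∈ (V p x).map Encodable.encode := by
      intro p t n h
      rw [stage_header] at h
      rw [← hc']
      exact Code.evaln_sound (by simpa using h.2)
    have hal : ∀ {t n}, stage (header (Encodable.encode c) ++ p, x) t = some n →
        alone (header (Encodable.encode c) ++ p, x) t := by
      intro t n h m _ ⟨h1, h2⟩
      obtain ⟨k, hk⟩ := Option.ne_none_iff_exists'.1 h2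
      generalize (Encodable.decode m : Option (List Bool)).getD [] = s at *
      obtain ⟨e, r, rfl⟩ : ∃ e p, s = header e ++ p := by
        apply eq_header
        intro h0
        simp [stage, h0] at hk
      obtain ⟨h3, h4⟩ := compat_prefix h1
      obtain ⟨rfl, hpr⟩ : e = Encodable.encode c ∧ (r <+: p ∨ p <+: r) := by
        rcases h4 with h4 | h4
        · exact ⟨(header_prefix h4).1, Or.inl (header_prefix h4).2⟩
        · exact ⟨(header_prefix h4).1.symm, Or.inr (header_prefix h4).2⟩
      have d1 : (V r x).Dom := (Part.dom_iff_mem.2 ⟨_, hst hk⟩ : ((V r x).map _).Dom)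
      have d2 : (V p x).Dom := (Part.dom_iff_mem.2 ⟨_, hst h⟩ : ((V p x).map _).Dom)
      apply h3
      rcases hpr with h | h
      · rw [hV.prefixFree x r p d1 d2 h]
      · rw [hV.prefixFree x p r d2 d1 h]
    ext y
    simp only [machine, Part.mem_bind_iff]
    constructor
    · rintro ⟨t, ht, hy⟩
      have h3 := Nat.rfind_spec ht
      simp only [Part.mem_some_iff] at h3
      obtain ⟨n, hn⟩ := Option.isSome_iff_exists.1 h3.symm
      rw [if_pos (hal hn), hn] at hy
      obtain ⟨z, hz, rfl⟩ := (Part.mem_map_iff _).1 (hst hn)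
      simpa using (by simpa using hy : y = z) ▸ hz
    · intro hy
      have h1 : Encodable.encode y ∈ Code.eval c (Encodable.encode (p, x)) := by
        rw [hc']; exact Part.mem_map _ hy
      obtain ⟨k, hk⟩ := Code.evaln_complete.1 h1
      have h2 : stage (header (Encodable.encode c) ++ p, x)
          (max k (Encodable.encode (header (Encodable.encode c) ++ p) + 1)) =
            some (Encodable.encode y) := by
        rw [stage_header]
        refine ⟨by omega, ?_⟩
        simpa using Code.evaln_mono (le_max_left _ _) hk
      obtain ⟨t, ht, hle⟩ := Nat.rfind_min' (p := fun t =>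
        (stage (header (Encodable.encode c) ++ p, x) t).isSome) (by rw [h2]; rfl)
      refine ⟨t, ht, ?_⟩
      have h3 := Nat.rfind_spec ht
      have h4 := (Part.mem_some_iff.1 h3).symm
      obtain ⟨n, hn⟩ := Option.isSome_iff_exists.1 h4
      have h5 := stage_mono hle hn
      rw [h2] at h5
      rw [if_pos (hal hn), hn, ← Option.some.inj h5]
      simp

end UniversalExistence

theorem exists_universalPrefixMachine : ∃ U, IsUniversalPrefixMachine U :=
  ⟨_, UniversalExistence.machine_isUniversal⟩

/-!
The distribution `D_x` is the universal prior conditioned on the solution set `A_x`. Conditioning is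
possible because the prior has total mass at most one by Kraft's inequality (`kraft_of_prefixFree`)
and gives every string positive mass (`universalPrior_pos`).

An oracle that samples `D_x` within variation distance `1/k` answers inside `A_x` with probability
at least `1 - 1/k`, since `D_x` lives on `A_x` (`one_sub_le_of_variationDist_le`). So the search
problem is solved by a single query `⟨⟨x, 0^k⟩, r⟩` with random `r`.

Conversely, a probabilistic machine `B` becomes a prefix machine when its coin sequence is read as
its program: a computation that has halted has used exactly its own coins, so the set of halting
coin sequences is prefix-free, and the weights `2^{-|p|}` of the sequences that lead to an output
`y` add up to at least the probability of `y`. Simulating `B` is primitive recursive, hence the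
universal machine simulates this prefix machine with a description of some length `m`, and
`2^{-m} B(y) ≤ U_x(y)` for all `x` and `y` (`exists_dominates`). Conditioning on `A_x` only increases
the prior on `A_x`, so the output distribution of `B` on `⟨x, 00⟩`, at least half of whose mass lies
in `A_x`, shares a mass of at least `2^{-m}/2` with `D_x` (`variationDist_le_of_dominates`). This is the
constant `η`; a sampler for `B` is turned into the required machine by the single query `⟨x, 00⟩`.

Both reductions use the same explicit oracle machine (`exists_queryMachine`): on input `w` it writes
`w` in paired form, appends `q(|w|)` relabelled coins, submits the query and halts with the answer.
The polynomial is counted by nested loops over the counter tapes, following Horner's rule. The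
machine is analysed backwards: a specification (`Spec`) says how the distribution of the final
output depends on the string written so far, and each step transforms the specification of its
successor.
-/

/-! ### Variation distance -/

/-- The variation distance is the mass that the two distributions do not share. -/
theorem variationDist_eq_one_sub {α : Type*} (P Q : PMF α) :
    variationDist P Q = 1 - (∑' a, min (P a) (Q a)).toReal := by
  have hP : HasSum (fun a => (P a).toReal) 1 := by
    have := ENNReal.hasSum_toReal P.tsum_coe_ne_top
    rwa [← ENNReal.tsum_toReal_eq P.apply_ne_top, P.tsum_coe] at this
  have hQ : HasSum (fun a => (Q a).toReal) 1 := by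
    have := ENNReal.hasSum_toReal Q.tsum_coe_ne_top
    rwa [← ENNReal.tsum_toReal_eq Q.apply_ne_top, Q.tsum_coe] at this
  have hmin : ∑' a, min (P a) (Q a) ≠ ⊤ :=
    ne_top_of_le_ne_top P.tsum_coe_ne_top (ENNReal.tsum_le_tsum fun a => min_le_left _ _)
  have hM := ENNReal.hasSum_toReal hmin
  rw [← ENNReal.tsum_toReal_eq fun a => ne_top_of_le_ne_top (P.apply_ne_top a) (min_le_left _ _)]
    at hM
  have key := (hP.add hQ).sub (hM.mul_left 2)
  have habs : (fun a => |(P a).toReal - (Q a).toReal|) = fun a =>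
      (P a).toReal + (Q a).toReal - 2 * (min (P a) (Q a)).toReal := by
    funext a
    rw [ENNReal.toReal_min (P.apply_ne_top a) (Q.apply_ne_top a)]
    linarith [max_sub_min_eq_abs' (P a).toReal (Q a).toReal,
      max_add_min (P a).toReal (Q a).toReal]
  rw [variationDist, habs, key.tsum_eq]
  ring

/-- A distribution close to one that lives on `A` gives high probability to `A`. -/
theorem one_sub_le_of_variationDist_le {α : Type*} {P Q : PMF α} {A : Set α}
    (hQ : ∀ a ∉ A, Q a = 0) {k : ℕ} (h : variationDist P Q ≤ 1 / (k : ℝ)) :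
    1 - (k : ENNReal)⁻¹ ≤ P.toOuterMeasure A := by
  rw [variationDist_eq_one_sub] at h
  have hle : ∑' a, min (P a) (Q a) ≤ P.toOuterMeasure A := by
    rw [PMF.toOuterMeasure_apply]
    refine ENNReal.tsum_le_tsum fun a => ?_
    by_cases ha : a ∈ A
    · simp [ha]
    · simp [ha, hQ a ha]
  refine le_trans ?_ hle
  have hfin : ∑' a, min (P a) (Q a) ≠ ⊤ :=
    ne_top_of_le_ne_top P.tsum_coe_ne_top (ENNReal.tsum_le_tsum fun a => min_le_left _ _)
  rcases Nat.eq_zero_or_pos k with rfl | hk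
  · simp
  rw [tsub_le_iff_right, ← ENNReal.toReal_le_toReal (by simp)
    (by simp [hfin, hk.ne']), ENNReal.toReal_add hfin (by simp [hk.ne'])]
  simp only [ENNReal.toReal_one, ENNReal.toReal_inv, ENNReal.toReal_natCast]
  rw [one_div] at h
  linarith

/-- If `Q` dominates `c P` on a set that has mass at least `δ` under `P`, then `P` and `Q` share a
mass of at least `c δ`. -/
theorem variationDist_le_of_dominates {α : Type*} {P Q : PMF α} {A : Set α} {c δ : ENNReal}
    (hc : c ≤ 1) (hPQ : ∀ a ∈ A, c * P a ≤ Q a) (hA : δ ≤ P.toOuterMeasure A) :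
    variationDist P Q ≤ 1 - (c * δ).toReal := by
  rw [variationDist_eq_one_sub]
  have hfin : ∑' a, min (P a) (Q a) ≠ ⊤ :=
    ne_top_of_le_ne_top P.tsum_coe_ne_top (ENNReal.tsum_le_tsum fun a => min_le_left _ _)
  refine sub_le_sub_left (ENNReal.toReal_mono hfin ?_) _
  refine (mul_le_mul_right hA c).trans ?_
  rw [PMF.toOuterMeasure_apply, ← ENNReal.tsum_mul_left]
  refine ENNReal.tsum_le_tsum fun a => ?_
  by_cases ha : a ∈ A
  · simpa [ha, hPQ a ha] using mul_le_of_le_one_left' hc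
  · simp [ha]

/-! ### Kraft's inequality -/

/-- Sums over bit strings, split by the first bit. -/
theorem tsum_list_bool (f : List Bool → ENNReal) :
    ∑' l, f l = f [] + ∑' b, ∑' l, f (b :: l) := by
  let e : Unit ⊕ Bool × List Bool ≃ List Bool :=
    { toFun := Sum.elim (fun _ => []) fun a => a.1 :: a.2
      invFun := fun l => l.casesOn (Sum.inl ()) fun b l => Sum.inr (b, l)
      left_inv := by rintro (_ | ⟨b, l⟩) <;> rfl
      right_inv := by rintro (_ | ⟨b, l⟩) <;> rfl }
  rw [← e.tsum_eq, Summable.tsum_sum ENNReal.summable ENNReal.summable,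
    ← ENNReal.tsum_prod (f := fun b l => f (b :: l))]
  simp [e]

/-- Kraft's inequality for the words of bounded length, by induction on the bound: the first bit
splits the set into two prefix-free sets of shorter words. -/
theorem kraft_length_le (n : ℕ) (P : Set (List Bool))
    (hP : ∀ p ∈ P, ∀ q ∈ P, p <+: q → p = q) :
    ∑' p, {p | p ∈ P ∧ p.length ≤ n}.indicator (fun p => (2⁻¹ : ENNReal) ^ p.length) p ≤ 1 := by
  induction n generalizing P with
  | zero =>
    rw [tsum_eq_single []]
    · exact (Set.indicator_le_self _ _ _).trans (by simp)
    · intro p hp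
      simp [Set.indicator, hp]
  | succ n ih =>
    rw [tsum_list_bool]
    by_cases h : [] ∈ P
    · have h0 : ∀ b l, (b :: l : List Bool) ∉ P := fun b l hbl => by
        simpa using hP [] h _ hbl List.nil_prefix
      simp [Set.indicator, h0, h]
    · have hb : ∀ b : Bool, ∑' l, {p | p ∈ P ∧ p.length ≤ n + 1}.indicator
          (fun p => (2⁻¹ : ENNReal) ^ p.length) (b :: l) ≤ 2⁻¹ := fun b => by
        have := ih {l | b :: l ∈ P} fun p hp q hq hpq => by
          simpa using hP _ hp _ hq (by simpa using hpq)
        calc _ = ∑' l, 2⁻¹ * {l | l ∈ {l | b :: l ∈ P} ∧ l.length ≤ n}.indicator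
              (fun p => (2⁻¹ : ENNReal) ^ p.length) l :=
              tsum_congr fun l => by
                classical simp [Set.indicator_apply, pow_succ, mul_comm]
          _ ≤ _ := by rw [ENNReal.tsum_mul_left]; exact mul_le_of_le_one_right' this
      rw [tsum_bool]
      simpa [Set.indicator, h, ENNReal.inv_two_add_inv_two] using add_le_add (hb false) (hb true)

/-- Kraft's inequality for a prefix-free set of any cardinality; the one-element set of the empty
string, which is not uniquely decodable, is allowed. -/
theorem kraft_of_prefixFree (P : Set (List Bool))
    (hP : ∀ p ∈ P, ∀ q ∈ P, p <+: q → p = q) :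
    ∑' p, P.indicator (fun p => (2⁻¹ : ENNReal) ^ p.length) p ≤ 1 := by
  rw [ENNReal.tsum_eq_iSup_sum]
  refine iSup_le fun s => ?_
  refine le_trans (Finset.sum_le_sum fun p hp => ?_)
    ((ENNReal.sum_le_tsum s).trans (kraft_length_le (s.sup List.length) P hP))
  have := Finset.le_sup (f := List.length) hp
  classical simp [Set.indicator_apply, this]

/-! ### The universal prior and its conditional distributions -/

theorem universalPrior_eq_tsum (V : List Bool → List Bool →. List Bool) (x y : List Bool) :
    universalPrior V x y =
      ∑' p, {p | y ∈ V p x}.indicator (fun p => (2⁻¹ : ENNReal) ^ p.length) p :=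
  tsum_subtype {p | y ∈ V p x} fun p => (2⁻¹ : ENNReal) ^ p.length

theorem IsPrefixMachine.tsum_universalPrior_le_one {V : List Bool → List Bool →. List Bool}
    (hV : IsPrefixMachine V) (x : List Bool) : ∑' y, universalPrior V x y ≤ 1 := by
  simp_rw [universalPrior_eq_tsum]
  rw [ENNReal.tsum_comm]
  refine le_trans (ENNReal.tsum_le_tsum fun p => ?_)
    (kraft_of_prefixFree {p | (V p x).Dom} fun p hp q hq => hV.prefixFree x p q hp hq)
  by_cases h : (V p x).Dom
  · rw [tsum_eq_single ((V p x).get h)]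
    · simp [Set.indicator, Part.get_mem, h]
    · intro y hy
      refine Set.indicator_of_notMem (fun hm => hy ?_) _
      exact (Part.get_eq_of_mem hm h).symm
  · have h0 : ∀ y, y ∉ V p x := fun y hy => h (Part.dom_iff_mem.2 ⟨y, hy⟩)
    simp [Set.indicator, h0]

/-- The universal prior dominates the output distribution of any prefix machine `V`, with the factor
`2^{-|w|}` for a description `w` of `V`. -/
theorem universalPrior_le_of_simulates {U V : List Bool → List Bool →. List Bool} {w : List Bool}
    (h : ∀ p x, U (w ++ p) x = V p x) (x y : List Bool) :
    2⁻¹ ^ w.length * universalPrior V x y ≤ universalPrior U x y := by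
  simp_rw [universalPrior_eq_tsum]
  rw [← ENNReal.tsum_mul_left]
  refine le_trans (ENNReal.tsum_le_tsum fun p => ?_)
    (ENNReal.tsum_comp_le_tsum_of_injective (List.append_right_injective w) _)
  classical
  simp [Set.indicator_apply, h, pow_add]

theorem IsUniversalPrefixMachine.universalPrior_pos {U : List Bool → List Bool →. List Bool}
    (hU : IsUniversalPrefixMachine U) (x y : List Bool) : universalPrior U x y ≠ 0 := by
  -- The machine that halts on the empty program alone, with output `y`.
  obtain ⟨w, hw⟩ := hU.simulates
    (fun p _ => Part.ofOption (if p = [] then some y else none))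
    { partrec := by
        refine Computable.ofOption (Primrec.to_comp ?_)
        exact Primrec.ite (Primrec.eq.comp Primrec.fst (Primrec.const []))
          (Primrec.const _) (Primrec.const _)
      prefixFree := fun x p q hp hq _ => by
        simp only [Part.ofOption_dom] at hp hq
        split_ifs at hp hq <;> simp_all }
  have hm : y ∈ U (w ++ []) x := by rw [hw]; simp
  refine (lt_of_lt_of_le ?_ (ENNReal.le_tsum (⟨_, hm⟩ : {p : List Bool // y ∈ U p x}))).ne'
  exact ENNReal.pow_pos (by simp) _

section ConditionedPrior

variable {U : List Bool → List Bool →. List Bool}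

theorem IsPrefixMachine.universalPrior_set_le_one (hU : IsPrefixMachine U)
    (x : List Bool) (A : Set (List Bool)) : ∑' z : A, universalPrior U x z ≤ 1 :=
  (ENNReal.tsum_comp_le_tsum_of_injective Subtype.val_injective _).trans
    (hU.tsum_universalPrior_le_one x)

theorem IsPrefixMachine.universalPrior_le_conditionedPrior (hU : IsPrefixMachine U)
    (x : List Bool) {A : Set (List Bool)} {y : List Bool} (hy : y ∈ A) :
    universalPrior U x y ≤ conditionedPrior U x A y := by
  rw [conditionedPrior, Set.indicator_of_mem hy, div_eq_mul_inv]
  exact le_mul_of_one_le_right' (ENNReal.one_le_inv.2 (hU.universalPrior_set_le_one x A))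

theorem IsUniversalPrefixMachine.tsum_conditionedPrior (hU : IsUniversalPrefixMachine U)
    (x : List Bool) {A : Set (List Bool)} (hA : A.Nonempty) :
    ∑' y, conditionedPrior U x A y = 1 := by
  obtain ⟨z, hz⟩ := hA
  simp_rw [conditionedPrior, div_eq_mul_inv]
  rw [ENNReal.tsum_mul_right, ← tsum_subtype]
  refine ENNReal.mul_inv_cancel ?_ ?_
  · refine (lt_of_lt_of_le (pos_iff_ne_zero.2 (hU.universalPrior_pos x z)) ?_).ne'
    exact ENNReal.le_tsum (f := fun z : A => universalPrior U x z) ⟨z, hz⟩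
  · exact ne_top_of_le_ne_top ENNReal.one_ne_top (hU.universalPrior_set_le_one x A)

/-- The sampling problem of the universal prior conditioned on the solutions of a search problem. -/
noncomputable def IsUniversalPrefixMachine.samplingProblem (hU : IsUniversalPrefixMachine U)
    (R : SearchProblem) : SamplingProblem where
  dist x := ⟨conditionedPrior U x (R.sol x),
    ENNReal.summable.hasSum_iff.2 (hU.tsum_conditionedPrior x (R.nonempty x))⟩
  len := R.len
  len_poly := R.len_poly
  length_eq x y hy := by
    refine R.length_eq x y ?_
    by_contra h
    exact ((PMF.mem_support_iff _ _).1 hy) (by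
      change conditionedPrior U x (R.sol x) y = 0
      simp [conditionedPrior, h])

theorem IsUniversalPrefixMachine.samplingProblem_dist (hU : IsUniversalPrefixMachine U)
    (R : SearchProblem) (x y : List Bool) :
    (hU.samplingProblem R).dist x y = conditionedPrior U x (R.sol x) y := rfl

end ConditionedPrior

/-! ### A probabilistic machine as a prefix machine -/

/-- `t` steps of a Markov chain from `c`, unfolded at the first step. -/
noncomputable def iterKernel {α : Type*} (κ : α → PMF α) : ℕ → α → PMF α
  | 0, c => PMF.pure c
  | t + 1, c => (κ c).bind (iterKernel κ t)

theorem iterKernel_succ' {α : Type*} (κ : α → PMF α) (t : ℕ) (c : α) :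
    iterKernel κ (t + 1) c = (iterKernel κ t c).bind κ := by
  induction t generalizing c with
  | zero => simp [iterKernel]
  | succ t ih =>
    rw [iterKernel, iterKernel, PMF.bind_bind]
    exact congrArg _ (funext ih)

namespace PTM

variable (B : PTM)

theorem run_eq_iterKernel (w : List Bool) (t : ℕ) :
    B.run w t = iterKernel B.step t (B.init w) := by
  induction t with
  | zero => rfl
  | succ t ih => rw [iterKernel_succ', ← ih, run]

/-- The configuration reached from `c` with the given coins, if the machine does not halt before all
coins are used. -/
def coinRun (c : B.Cfg) (p : List Bool) : Option B.Cfg :=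
  p.foldl (fun o b => o.bind fun c => if c.state = B.halt then none else some (B.next c b)) (some c)

/-- The output of the machine started at `c` whose coin sequence, up to the moment of halting, is
exactly `p`. -/
def coinOut (c : B.Cfg) (p : List Bool) : Option (List Bool) :=
  (B.coinRun c p).bind fun c => if c.state = B.halt then some (B.out c) else none

theorem foldl_none (p : List Bool) :
    p.foldl (fun o b => o.bind fun c : B.Cfg =>
      if c.state = B.halt then none else some (B.next c b)) none = none := by
  induction p with
  | nil => rfl
  | cons b p ih => simpa using ih

theorem coinOut_nil (c : B.Cfg) :
    B.coinOut c [] = if c.state = B.halt then some (B.out c) else none := by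
  simp [coinOut, coinRun]

theorem coinOut_cons (c : B.Cfg) (b : Bool) (p : List Bool) :
    B.coinOut c (b :: p) = if c.state = B.halt then none else B.coinOut (B.next c b) p := by
  by_cases h : c.state = B.halt <;> simp [coinOut, coinRun, h, foldl_none]

theorem coinOut_prefixFree {c : B.Cfg} {p q : List Bool} (hp : (B.coinOut c p).isSome)
    (hq : (B.coinOut c q).isSome) (h : p <+: q) : p = q := by
  induction p generalizing c q with
  | nil =>
    cases q with
    | nil => rfl
    | cons b q =>
      rw [coinOut_nil] at hp
      rw [coinOut_cons] at hq
      split_ifs at hp hq <;> simp_all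
  | cons b p ih =>
    obtain ⟨r, rfl⟩ := h
    rw [List.cons_append, coinOut_cons] at hq
    rw [coinOut_cons] at hp
    split_ifs at hp hq
    · simp at hp
    · rw [List.cons_append, ← ih hp hq (List.prefix_append p r)]

/-- The probability of halting with output `y` is at most the total weight `2^{-|p|}` of the coin
sequences `p` that lead to it. -/
theorem iterKernel_step_le_tsum (t : ℕ) (c : B.Cfg) (y : List Bool) :
    (iterKernel B.step t c).toOuterMeasure {c | c.state = B.halt ∧ B.out c = y} ≤
      ∑' p, {p | B.coinOut c p = some y}.indicator (fun p => (2⁻¹ : ENNReal) ^ p.length) p := by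
  have hhalt : ∀ c : B.Cfg, (PMF.pure c).toOuterMeasure {c | c.state = B.halt ∧ B.out c = y} ≤
      ∑' p, {p | B.coinOut c p = some y}.indicator (fun p => (2⁻¹ : ENNReal) ^ p.length) p := by
    intro c
    rw [PMF.toOuterMeasure_pure_apply]
    split_ifs with h
    · refine le_trans ?_ (ENNReal.le_tsum [])
      rw [Set.indicator_of_mem (by simpa [coinOut_nil, h.1] using h.2)]
      simp
    · exact zero_le
  induction t generalizing c with
  | zero => exact hhalt c
  | succ t ih =>
    by_cases h : c.state = B.halt
    · have hfix : ∀ t, iterKernel B.step t c = PMF.pure c := by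
        intro t
        induction t with
        | zero => rfl
        | succ t ih => rw [iterKernel, step, if_pos h, PMF.pure_bind, ih]
      rw [hfix]
      exact hhalt c
    · rw [iterKernel, PMF.toOuterMeasure_bind_apply, step, if_neg h, tsum_list_bool]
      refine le_trans ?_ le_add_self
      have hmap : ∀ f : B.Cfg → ENNReal,
          ∑' c', ((PMF.uniformOfFintype Bool).map (B.next c)) c' * f c' =
            ∑' b, 2⁻¹ * f (B.next c b) := by
        intro f
        simp_rw [PMF.map_apply, ← ENNReal.tsum_mul_right]
        rw [ENNReal.tsum_comm]
        refine tsum_congr fun b => ?_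
        rw [tsum_eq_single (B.next c b)]
        · simp
        · intro c' hc'
          simp [hc']
      rw [hmap]
      refine ENNReal.tsum_le_tsum fun b => ?_
      refine (mul_le_mul_right (ih (B.next c b)) _).trans ?_
      rw [← ENNReal.tsum_mul_left]
      refine ENNReal.tsum_le_tsum fun p => ?_
      classical
      simp [Set.indicator_apply, coinOut_cons, h, pow_succ']

theorem outProb_le_tsum (w y : List Bool) :
    B.outProb w y ≤ ∑' p, {p | B.coinOut (B.init w) p = some y}.indicator
      (fun p => (2⁻¹ : ENNReal) ^ p.length) p :=
  iSup_le fun t => by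
    rw [run_eq_iterKernel]
    exact B.iterKernel_step_le_tsum t _ y

end PTM

/-! ### Simulating a probabilistic machine is primitive recursive -/

namespace BitTape

/-- A tape as a pair of lists, for the use of `Primcodable`. -/
def equivProd : BitTape ≃ List (Option Bool) × List (Option Bool) where
  toFun t := (t.left, t.right)
  invFun a := ⟨a.1, a.2⟩
  left_inv _ := rfl
  right_inv _ := rfl

instance : Primcodable BitTape := Primcodable.ofEquiv _ equivProd

theorem left_primrec : Primrec BitTape.left :=
  Primrec.fst.comp (Primrec.of_equiv (e := equivProd))

theorem right_primrec : Primrec BitTape.right :=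
  Primrec.snd.comp (Primrec.of_equiv (e := equivProd))

theorem mk_primrec : Primrec₂ BitTape.mk :=
  (Primrec.of_equiv_symm (e := equivProd)).to₂

theorem headD_primrec : Primrec fun l : List (Option Bool) => l.headD none :=
  (Primrec.option_getD.comp Primrec.list_head? (Primrec.const none)).of_eq fun l => by
    cases l <;> rfl

theorem read_primrec : Primrec BitTape.read := headD_primrec.comp right_primrec

theorem write_primrec : Primrec₂ BitTape.write :=
  mk_primrec.comp (left_primrec.comp Primrec.fst)
    (Primrec.list_cons.comp Primrec.snd
      (Primrec.list_tail.comp (right_primrec.comp Primrec.fst)))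

theorem move_primrec (d : Option Turing.Dir) : Primrec fun t : BitTape => t.move d := by
  rcases d with _ | _ | _
  · exact Primrec.id
  · exact mk_primrec.comp (Primrec.list_tail.comp left_primrec)
      (Primrec.list_cons.comp (headD_primrec.comp left_primrec) right_primrec)
  · exact mk_primrec.comp (Primrec.list_cons.comp read_primrec left_primrec)
      (Primrec.list_tail.comp right_primrec)

theorem ofString_primrec : Primrec BitTape.ofString :=
  mk_primrec.comp (Primrec.const [])
    (Primrec.list_map Primrec.id (Primrec.option_some.comp Primrec.snd).to₂)

theorem contents_primrec : Primrec BitTape.contents :=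
  (Primrec.listFilterMap (Primrec.list_append.comp
    (Primrec.list_reverse.comp left_primrec) right_primrec) Primrec.snd.to₂).of_eq fun _ => rfl

end BitTape

/-- A case distinction on an argument from a finite type is primitive recursive. -/
theorem primrec₂_of_finite_left {α β σ : Type*} [Primcodable α] [Primcodable β] [Primcodable σ]
    [Finite α] {f : α → β → σ} (h : ∀ a, Primrec (f a)) : Primrec₂ f := by
  obtain ⟨n, ⟨e⟩⟩ := Finite.exists_equiv_fin α
  have hg : Primrec₂ fun (i : Fin n) (b : β) => f (e.symm i) b :=
    Primrec.fin_curry₁.2 fun i => h _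
  exact (hg.comp ((Primrec.dom_finite e).comp Primrec.fst) Primrec.snd).of_eq fun a => by simp

namespace PTM

variable (B : PTM)

noncomputable instance : Primcodable B.State :=
  Primcodable.ofEquiv (Fin (Fintype.card B.State)) (Fintype.equivFin B.State)

noncomputable instance {α : Type*} [Primcodable α] : Primcodable (B.TapeIdx → α) :=
  Primcodable.ofEquiv (Fin (Fintype.card B.TapeIdx) → α)
    ((Fintype.equivFin B.TapeIdx).arrowCongr (Equiv.refl α))

variable {B}

theorem primrec_tapes_iff {α β : Type*} [Primcodable α] [Primcodable β]
    {f : β → B.TapeIdx → α} : Primrec f ↔ ∀ i, Primrec fun b => f b i := by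
  let e := (Fintype.equivFin B.TapeIdx)
  have h1 : Primrec f ↔ Primrec fun b (j : Fin (Fintype.card B.TapeIdx)) => f b (e.symm j) :=
    (Primrec.of_equiv_iff (e.arrowCongr (Equiv.refl α))).symm
  rw [h1, Primrec.fin_curry]
  constructor
  · intro h i
    exact (h.comp Primrec.id (Primrec.const (e i))).of_eq fun b => by simp
  · intro h
    exact (Primrec.fin_curry₁.2 fun j => h (e.symm j)).swap

/-- A configuration as a pair, for the use of `Primcodable`. -/
def cfgEquivProd : B.Cfg ≃ B.State × (B.TapeIdx → BitTape) where
  toFun c := (c.state, c.tape)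
  invFun a := ⟨a.1, a.2⟩
  left_inv _ := rfl
  right_inv _ := rfl

noncomputable instance : Primcodable B.Cfg := Primcodable.ofEquiv _ cfgEquivProd

theorem state_primrec : Primrec (Cfg.state (M := B)) :=
  Primrec.fst.comp (Primrec.of_equiv (e := cfgEquivProd))

theorem tape_primrec (i : B.TapeIdx) : Primrec fun c : B.Cfg => c.tape i :=
  primrec_tapes_iff.1 (Primrec.snd.comp (Primrec.of_equiv (e := cfgEquivProd))) i

theorem cfg_mk_primrec : Primrec₂ (Cfg.mk (M := B)) :=
  (Primrec.of_equiv_symm (e := cfgEquivProd)).to₂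

variable (B)

theorem next_primrec : Primrec₂ B.next := by
  have hkey : Primrec fun a : B.Cfg × Bool =>
      ((a.1.state, fun i => (a.1.tape i).read, a.2) :
        B.State × (B.TapeIdx → Option Bool) × Bool) := by
    refine Primrec.pair (state_primrec.comp Primrec.fst) (Primrec.pair ?_ Primrec.snd)
    exact primrec_tapes_iff.2 fun i =>
      BitTape.read_primrec.comp ((tape_primrec i).comp Primrec.fst)
  refine cfg_mk_primrec.comp ((Primrec.dom_finite fun k : B.State × (B.TapeIdx → Option Bool) ×
    Bool => (B.trans k.1 k.2.1 k.2.2).1).comp hkey) (primrec_tapes_iff.2 fun i => ?_)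
  have h : Primrec₂ fun (k : B.State × (B.TapeIdx → Option Bool) × Bool) (t : BitTape) =>
      (t.write ((B.trans k.1 k.2.1 k.2.2).2 i).1).move ((B.trans k.1 k.2.1 k.2.2).2 i).2 :=
    primrec₂_of_finite_left fun k => (BitTape.move_primrec _).comp
      (BitTape.write_primrec.comp Primrec.id (Primrec.const _))
  exact h.comp hkey ((tape_primrec i).comp Primrec.fst)

theorem init_primrec : Primrec B.init := by
  refine cfg_mk_primrec.comp (Primrec.const B.start) (primrec_tapes_iff.2 fun i => ?_)
  refine BitTape.ofString_primrec.comp ?_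
  by_cases h : i = B.inputTape
  · simp only [if_pos h]
    exact Primrec.id
  · simpa [h] using Primrec.const []

theorem coinOut_primrec : Primrec₂ B.coinOut := by
  have hhalt : PrimrecPred fun c : B.Cfg => c.state = B.halt :=
    Primrec.eq.comp state_primrec (Primrec.const _)
  refine Primrec.option_bind ?_ ?_
  · refine Primrec.list_foldl (f := fun a : B.Cfg × List Bool => a.2)
      (g := fun a => some a.1) (h := fun _ s => s.1.bind fun c =>
        if c.state = B.halt then none else some (B.next c s.2))
      Primrec.snd (Primrec.option_some.comp Primrec.fst) ?_
    refine Primrec.option_bind (Primrec.fst.comp Primrec.snd) ?_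
    refine Primrec.ite (hhalt.comp Primrec.snd) (Primrec.const none) ?_
    exact Primrec.option_some.comp (B.next_primrec.comp Primrec.snd
      (Primrec.snd.comp (Primrec.snd.comp Primrec.fst)))
  · refine Primrec.ite (hhalt.comp Primrec.snd) ?_ (Primrec.const none)
    exact Primrec.option_some.comp
      (BitTape.contents_primrec.comp ((tape_primrec B.outputTape).comp Primrec.snd))

end PTM

theorem primrec_pairStr_left (z : List Bool) : Primrec fun x => pairStr x z :=
  Primrec.list_append.comp (Primrec.list_append.comp
    (Primrec.list_flatMap Primrec.id (Primrec.list_cons.comp Primrec.snd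
      (Primrec.list_cons.comp Primrec.snd (Primrec.const []))).to₂)
    (Primrec.const _)) (Primrec.const _)

/-- The output of a probabilistic machine `B` is dominated by the universal prior: `B`, with its
coin sequence as program, is itself a prefix machine, because a halting computation has read exactly
its own coins. -/
theorem IsUniversalPrefixMachine.exists_dominates {U : List Bool → List Bool →. List Bool}
    (hU : IsUniversalPrefixMachine U) (B : PTM)
    (z : List Bool) : ∃ m : ℕ, ∀ x y,
      2⁻¹ ^ m * B.outProb (pairStr x z) y ≤ universalPrior U x y := by
  obtain ⟨w, hw⟩ := hU.simulates (fun p x => Part.ofOption (B.coinOut (B.init (pairStr x z)) p))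
    { partrec := Computable.ofOption (Primrec.to_comp (B.coinOut_primrec.comp
        (B.init_primrec.comp ((primrec_pairStr_left z).comp Primrec.snd)) Primrec.fst))
      prefixFree := fun x p q hp hq h => B.coinOut_prefixFree (by simpa using hp)
        (by simpa using hq) h }
  refine ⟨w.length, fun x y => le_trans ?_ (universalPrior_le_of_simulates hw x y)⟩
  gcongr
  refine (B.outProb_le_tsum _ y).trans_eq (Eq.trans ?_ (universalPrior_eq_tsum _ x y).symm)
  simp [Part.mem_ofOption]

/-! ### Uniformly random strings -/

theorem uniformBits_apply (n : ℕ) (y : List Bool) :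
    uniformBits n y = if y.length = n then 2⁻¹ ^ n else 0 := by
  rw [uniformBits]
  refine (PMF.map_apply _ _ _).trans ?_
  split_ifs with h
  · rw [tsum_eq_single (⟨y, h⟩ : List.Vector Bool n)]
    · rw [if_pos rfl]
      refine (PMF.uniformOfFintype_apply (α := List.Vector Bool n) _).trans ?_
      rw [card_vector, Fintype.card_bool, Nat.cast_pow, ENNReal.inv_pow, Nat.cast_ofNat]
    · intro v hv
      rw [if_neg]
      rintro rfl
      exact hv rfl
  · refine ENNReal.tsum_eq_zero.2 fun v => ?_
    rw [if_neg]
    rintro rfl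
    exact h v.2

theorem uniformBits_succ (n : ℕ) :
    uniformBits (n + 1) =
      (PMF.uniformOfFintype Bool).bind fun b => (uniformBits n).map (b :: ·) := by
  ext y
  rw [PMF.bind_apply, uniformBits_apply]
  have hmap : ∀ b : Bool, ((uniformBits n).map (b :: ·)) y =
      if y.head? = some b then uniformBits n y.tail else 0 := by
    intro b
    rw [PMF.map_apply]
    cases y with
    | nil => simp
    | cons a y =>
      rw [tsum_eq_single y (fun z hz => by simp [hz.symm])]
      simp
  simp only [hmap, tsum_bool, uniformBits_apply]
  rcases y with _ | ⟨_ | _, y⟩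
  · simp
  all_goals
    simp only [List.length_cons, Nat.add_right_cancel_iff, pow_succ']
    split_ifs <;> simp_all

/-! ### Backward reasoning about oracle machines -/

namespace OracleTM

/-- From `c`, the machine surely halts within `t` steps, and its output has distribution `μ`. -/
def Yields (M : OracleTM) (O : Oracle) (c : M.toPTM.Cfg) (t : ℕ) (μ : PMF (List Bool)) : Prop :=
  (iterKernel (M.oracleStep O) t c).map
    (fun c => if c.state = M.halt then some (M.toPTM.out c) else none) = μ.map some

variable {M : OracleTM} {O : Oracle} {c : M.toPTM.Cfg} {t : ℕ} {μ : PMF (List Bool)}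

theorem Yields.coin {ν : Bool → PMF (List Bool)} (h1 : c.state ≠ M.halt) (h2 : c.state ≠ M.query)
    (h : ∀ b, M.Yields O (M.toPTM.next c b) t (ν b)) :
    M.Yields O c (t + 1) ((PMF.uniformOfFintype Bool).bind ν) := by
  unfold Yields at *
  rw [iterKernel, oracleStep, if_neg h1, if_neg h2, PMF.bind_map, PMF.map_bind, PMF.map_bind]
  exact congrArg _ (funext h)

theorem Yields.ask (h1 : c.state = M.query) (h2 : M.query ≠ M.halt) (h3 : M.resume = M.halt)
    (h4 : M.outputTape = M.oracleTape) :
    M.Yields O c 1 (O (c.tape M.oracleTape).contents) := by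
  have hc : ∀ a, (BitTape.ofString a).contents = a := fun a => by
    simp [BitTape.contents, BitTape.ofString, List.reduceOption]
  unfold Yields
  rw [iterKernel, oracleStep, h1, if_neg h2, if_pos rfl, PMF.bind_map, PMF.map_bind]
  simp only [iterKernel, Function.comp_def, PMF.pure_map, h3, PTM.out, h4, if_true,
    Function.update_self, hc]
  rfl

theorem oracleRun_eq_iterKernel (M : OracleTM) (O : Oracle) (w : List Bool) (t : ℕ) :
    M.oracleRun O w t = iterKernel (M.oracleStep O) t (M.toPTM.init w) := by
  induction t with
  | zero => rfl
  | succ t ih => rw [iterKernel_succ', ← ih, oracleRun]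

theorem Yields.haltsWithin {w : List Bool} (h : M.Yields O (M.toPTM.init w) t μ) :
    M.HaltsWithin O w t := by
  intro c hc
  rw [oracleRun_eq_iterKernel] at hc
  have hm : (if c.state = M.halt then some (M.toPTM.out c) else none) ∈ (μ.map some).support := by
    rw [← h, PMF.support_map]
    exact ⟨c, hc, rfl⟩
  by_contra hn
  simp [PMF.support_map, hn] at hm

theorem Yields.outputAt_eq {w : List Bool} (h : M.Yields O (M.toPTM.init w) t μ) :
    M.outputAt O w t = μ := by
  have h1 := h.haltsWithin
  have h2 := congrArg (PMF.map fun o : Option (List Bool) => o.getD []) h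
  simp only [PMF.map_comp, Function.comp_def, Option.getD_some] at h2
  rw [← oracleRun_eq_iterKernel, show PMF.map (fun x => x) μ = μ from PMF.map_id μ] at h2
  rw [← h2, outputAt]
  ext y
  rw [PMF.map_apply, PMF.map_apply]
  refine tsum_congr fun c => ?_
  by_cases hc : c ∈ (M.oracleRun O w t).support
  · simp [h1 c hc]
  · simp [(PMF.apply_eq_zero_iff _ _).2 hc]

end OracleTM

/-! ### Tapes used as input, as counters and as output -/

namespace BitTape

/-- The symbol at the given distance to the right of the head. -/
def cell (t : BitTape) : ℤ → Option Bool
  | Int.ofNat i => t.right.getD i none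
  | Int.negSucc i => t.left.getD i none

/-- The displacement of a head. -/
def shift : Option Turing.Dir → ℤ
  | none => 0
  | some Turing.Dir.left => -1
  | some Turing.Dir.right => 1

theorem read_eq_cell (t : BitTape) : t.read = t.cell 0 := by
  rcases t with ⟨l, _ | ⟨a, r⟩⟩ <;> rfl

theorem cell_write (t : BitTape) (a : Option Bool) (z : ℤ) :
    (t.write a).cell z = if z = 0 then a else t.cell z := by
  rcases t with ⟨l, _ | ⟨b, r⟩⟩ <;> rcases z with (_ | i) | i <;> simp [cell, write] <;> omega

theorem cell_move (t : BitTape) (d : Option Turing.Dir) (z : ℤ) :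
    (t.move d).cell z = t.cell (z + shift d) := by
  rcases d with _ | _ | _
  · simp [move, shift]
  · rcases z with (_ | i) | i
    · rcases t with ⟨_ | ⟨a, l⟩, r⟩ <;> rfl
    · have : (Int.ofNat (i + 1) + shift (some Turing.Dir.left)) = Int.ofNat i := by
        simp [shift]
      rw [this]
      simp [move, cell]
    · have : (Int.negSucc i + shift (some Turing.Dir.left)) = Int.negSucc (i + 1) := by
        simp [shift]; omega
      rw [this]
      rcases t with ⟨_ | ⟨a, l⟩, r⟩ <;> simp [move, cell]
  · rcases z with i | _ | i
    · have : (Int.ofNat i + shift (some Turing.Dir.right)) = Int.ofNat (i + 1) := by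
        simp [shift]
      rw [this]
      rcases t with ⟨l, _ | ⟨a, r⟩⟩ <;> simp [move, cell]
    · rcases t with ⟨l, _ | ⟨a, r⟩⟩ <;> rfl
    · have : (Int.negSucc (i + 1) + shift (some Turing.Dir.right)) = Int.negSucc i := by
        simp [shift]; omega
      rw [this]
      simp [move, cell]

/-- The string `s` starts at the head, followed by blanks. -/
def HasInput (s : List Bool) (t : BitTape) : Prop := ∀ i : ℕ, t.cell i = s[i]?

/-- A block of `n` marks, with the head at position `k` relative to its first mark. -/
def IsCounter (n : ℕ) (k : ℤ) (t : BitTape) : Prop :=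
  ∀ z, t.cell z = if 0 ≤ z + k ∧ z + k < n then some true else none

/-- The string `s` ends immediately to the left of the head, and blanks follow. -/
def HasOutput (s : List Bool) (t : BitTape) : Prop :=
  t.left = s.reverse.map some ∧ ∀ a ∈ t.right, a = none

variable {s : List Bool} {t : BitTape} {n : ℕ} {k : ℤ}

theorem HasInput.read (h : t.HasInput s) : t.read = s.head? := by
  rw [read_eq_cell, List.head?_eq_getElem?]
  exact h 0

theorem HasInput.stay (h : t.HasInput s) : ((t.write t.read).move none).HasInput s := by
  intro i
  rw [cell_move, cell_write, read_eq_cell, ← h i]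
  rcases i with _ | i
  · simp [shift]
  · rw [if_neg (by simp only [shift]; omega)]
    simp [shift]

theorem HasInput.right (h : t.HasInput s) :
    ((t.write t.read).move (some Turing.Dir.right)).HasInput s.tail := by
  intro i
  rw [cell_move, cell_write, if_neg (by simp only [shift]; omega), List.getElem?_tail, ← h (i + 1)]
  rfl

theorem IsCounter.read (h : t.IsCounter n k) :
    t.read = if 0 ≤ k ∧ k < n then some true else none := by
  rw [read_eq_cell, h 0, zero_add]

theorem IsCounter.move (h : t.IsCounter n k) (d : Option Turing.Dir) :
    ((t.write t.read).move d).IsCounter n (k + shift d) := by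
  intro z
  rw [cell_move, cell_write, read_eq_cell]
  split_ifs with h0
  all_goals first | rw [← h0, h] | rw [h]
  all_goals grind

theorem IsCounter.mark (h : t.IsCounter n n) :
    ((t.write (some true)).move (some Turing.Dir.right)).IsCounter (n + 1) (n + 1) := by
  intro z
  rw [cell_move, cell_write, h]
  simp only [shift]
  grind

theorem HasOutput.stay (h : t.HasOutput s) : ((t.write t.read).move none).HasOutput s := by
  rcases t with ⟨l, _ | ⟨a, r⟩⟩ <;> simpa [HasOutput, write, BitTape.read, BitTape.move] using h

theorem HasOutput.append (h : t.HasOutput s) (b : Bool) :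
    ((t.write (some b)).move (some Turing.Dir.right)).HasOutput (s ++ [b]) := by
  refine ⟨?_, fun a ha => h.2 a (List.mem_of_mem_tail ?_)⟩
  · simp [BitTape.move, write, BitTape.read, h.1]
  · simpa [BitTape.move, write] using ha

theorem HasOutput.contents (h : t.HasOutput s) : t.contents = s := by
  have : t.right.reduceOption = [] := by
    rw [List.reduceOption, List.filterMap_eq_nil_iff]
    exact h.2
  rw [BitTape.contents, h.1, List.reduceOption_append, this]
  simp [List.reduceOption, List.filterMap_map]

end BitTape

/-! ### The machine that asks one randomized query -/

namespace QueryMachine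

/-- The states: copying (each bit is written twice), the mark `01`, the counting program, and the
query. In `fwd i` instruction `i` is about to be carried out, in `back i` the program from
instruction `i` on is finished, and in `rew i` the counter of the loop `i` is rewound. -/
inductive State (N : ℕ)
  | copyFst | copySnd | sep
  | fwd (i : Fin N) | back (i : Fin N) | rew (i : Fin N)
  | query | halt
  deriving DecidableEq, Fintype

/-- What the machine does in one step, apart from the tape encoding. -/
structure Action (N : ℕ) where
  /-- The next state. -/
  state : State N
  /-- A bit to be appended on the oracle tape. -/
  emit : Option Bool := none
  /-- Whether to advance on the input tape. -/
  advance : Bool := false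
  /-- Whether to write a mark on all counters. -/
  mark : Bool := false
  /-- The moves on the counters. -/
  move : Fin N → Option Turing.Dir := fun _ => none

variable (l : List Bool) (g : Bool → Bool)

/-- The instruction number `k`, as a state index. -/
abbrev ix (k : ℕ) : Fin (l.length + 1) := Fin.ofNat (l.length + 1) k

/-- The control of the machine, as a function of the scanned input symbol, of the scanned symbols of
the counters, and of the coin. -/
def action (s : State (l.length + 1)) (inp : Option Bool)
    (ctr : Fin (l.length + 1) → Option Bool) (b : Bool) : Action (l.length + 1) :=
  match s with
  | .copyFst => match inp with
    | some a => { state := .copySnd, emit := some a }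
    | none => { state := .sep, emit := some false }
  | .copySnd => { state := .copyFst, emit := inp, advance := true, mark := true
                  move := fun _ => some Turing.Dir.right }
  | .sep => { state := .fwd (ix l 0), emit := some true, move := fun _ => some Turing.Dir.left }
  | .fwd i => match l[i.1]? with
    | none => { state := .back i }
    | some true => { state := .fwd (ix l (i.1 + 1)), emit := some (g b) }
    | some false =>
      if ctr i = none then
        { state := .rew i, move := Function.update (fun _ => none) i (some Turing.Dir.right) }
      else { state := .fwd (ix l (i.1 + 1))
             move := Function.update (fun _ => none) i (some Turing.Dir.left) }
  | .back i =>
    if i.1 = 0 then { state := .query }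
    else if l[i.1 - 1]? = some true then { state := .back (ix l (i.1 - 1)) }
    else { state := .fwd (ix l (i.1 - 1)) }
  | .rew i =>
    if ctr i = none then
      { state := .back i, move := Function.update (fun _ => none) i (some Turing.Dir.left) }
    else
      { state := .rew i, move := Function.update (fun _ => none) i (some Turing.Dir.right) }
  | .query => { state := .halt }
  | .halt => { state := .halt }

/-- The oracle machine for the counting program `l` (`true` is a tick, `false` a loop over the rest of
the program) and the relabelling `g` of its coins. Its tapes are the oracle tape `none`, which is
also the output tape, the input tape `some none`, and one counter `some (some i)` for each
instruction. It halts as soon as the query is answered. -/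
def machine : OracleTM where
  State := State (l.length + 1)
  TapeIdx := Option (Option (Fin (l.length + 1)))
  start := .copyFst
  halt := .halt
  inputTape := some none
  outputTape := none
  trans s r b :=
    let a := action l g s (r (some none)) (fun i => r (some (some i))) b
    (a.state, fun
      | none => match a.emit with
        | none => (r none, none)
        | some b => (some b, some Turing.Dir.right)
      | some none => (r (some none), if a.advance then some Turing.Dir.right else none)
      | some (some i) => (if a.mark then some true else r (some (some i)), a.move i))
  oracleTape := none
  query := .query
  resume := .halt

/-- The configuration has state `s`, rest of the input `inp`, counters with `n` marks and head
positions `pos`, and the string `o` on the oracle tape. -/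
structure Matches (s : State (l.length + 1)) (inp : List Bool) (n : ℕ)
    (pos : Fin (l.length + 1) → ℤ) (o : List Bool) (c : (machine l g).toPTM.Cfg) : Prop where
  state : c.state = s
  input : (c.tape (some none)).HasInput inp
  counter : ∀ i, (c.tape (some (some i))).IsCounter n (pos i)
  output : (c.tape none).HasOutput o

variable {l g}

/-- The action of the control, carried out on the data that describe a configuration. -/
theorem Matches.next {s : State (l.length + 1)} {inp : List Bool} {n : ℕ}
    {pos : Fin (l.length + 1) → ℤ} {o : List Bool} {c : (machine l g).toPTM.Cfg}
    (h : Matches l g s inp n pos o c) (b : Bool) {a : Action (l.length + 1)}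
    (ha : action l g s inp.head? (fun i => if 0 ≤ pos i ∧ pos i < n then some true else none) b = a)
    (hm : a.mark = true → ∀ i, pos i = n ∧ a.move i = some Turing.Dir.right) :
    Matches l g a.state (if a.advance then inp.tail else inp) (if a.mark then n + 1 else n)
      (fun i => pos i + BitTape.shift (a.move i)) (o ++ a.emit.toList)
      ((machine l g).toPTM.next c b) := by
  have hr : action l g c.state (c.tape (some none)).read
      (fun i => (c.tape (some (some i))).read) b = a := by
    rw [h.state, h.input.read, ← ha]
    exact congrArg (fun f => action l g s inp.head? f b) (funext fun i => (h.counter i).read)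
  refine ⟨?_, ?_, fun i => ?_, ?_⟩
  · simp only [PTM.next, machine, hr]
  · simp only [PTM.next, machine, hr]
    split_ifs
    · exact h.input.right
    · exact h.input.stay
  · simp only [PTM.next, machine, hr]
    split_ifs with h1
    · obtain ⟨h2, h3⟩ := hm h1 i
      have := h.counter i
      rw [h2] at this
      rw [h2, h3]
      exact_mod_cast this.mark
    · exact (h.counter i).move _
  · simp only [PTM.next, machine, hr]
    rcases a.emit with _ | b
    · simpa using h.output.stay
    · exact h.output.append b

theorem matches_init (w : List Bool) :
    Matches l g .copyFst w 0 (fun _ => 0) [] ((machine l g).toPTM.init w) := by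
  refine ⟨rfl, fun i => ?_, fun i z => ?_, ?_⟩
  · rcases h : w[i]? <;> simp [PTM.init, machine, BitTape.ofString, BitTape.cell, h]
  · rcases z with z | z <;> simp [PTM.init, machine, BitTape.ofString, BitTape.cell]
  · simp [PTM.init, machine, BitTape.ofString, BitTape.HasOutput]

/-! ### Specifications of the single steps -/

variable {O : Oracle}

/-- From any configuration with the given data the machine surely halts within `t` steps, and its
output has distribution `K o`, where `o` is the string on the oracle tape. -/
def Spec (l : List Bool) (g : Bool → Bool) (O : Oracle) (s : State (l.length + 1))
    (inp : List Bool) (n : ℕ) (pos : Fin (l.length + 1) → ℤ) (t : ℕ)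
    (K : List Bool → PMF (List Bool)) : Prop :=
  ∀ o c, Matches l g s inp n pos o c → (machine l g).Yields O c t (K o)

/-- A step from `s`, where `a b` is the action when the coin shows `b`: the specification after the
step gives the one before it. -/
theorem Spec.coin {s : State (l.length + 1)} {inp : List Bool} {n : ℕ}
    {pos : Fin (l.length + 1) → ℤ} {t : ℕ} {K : List Bool → PMF (List Bool)}
    (a : Bool → Action (l.length + 1))
    (ha : ∀ b, action l g s inp.head?
      (fun i => if 0 ≤ pos i ∧ pos i < n then some true else none) b = a b)
    (hm : ∀ b, (a b).mark = true → ∀ i, pos i = n ∧ (a b).move i = some Turing.Dir.right)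
    (hs : s ≠ .halt ∧ s ≠ .query)
    (h : ∀ b, Spec l g O (a b).state (if (a b).advance then inp.tail else inp)
      (if (a b).mark then n + 1 else n) (fun i => pos i + BitTape.shift ((a b).move i)) t K) :
    Spec l g O s inp n pos (t + 1)
      (fun o => (PMF.uniformOfFintype Bool).bind fun b => K (o ++ (a b).emit.toList)) := by
  intro o c hc
  refine OracleTM.Yields.coin (hc.state ▸ hs.1) (hc.state ▸ hs.2) fun b => ?_
  exact h b _ _ (hc.next b (ha b) (hm b))

/-- `Spec.coin` for a step that ignores its coin. -/
theorem Spec.det {s : State (l.length + 1)} {inp : List Bool} {n : ℕ}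
    {pos : Fin (l.length + 1) → ℤ} {t : ℕ} {K : List Bool → PMF (List Bool)}
    (a : Action (l.length + 1))
    (ha : ∀ b, action l g s inp.head?
      (fun i => if 0 ≤ pos i ∧ pos i < n then some true else none) b = a)
    (hm : a.mark = true → ∀ i, pos i = n ∧ a.move i = some Turing.Dir.right)
    (hs : s ≠ .halt ∧ s ≠ .query)
    (h : Spec l g O a.state (if a.advance then inp.tail else inp)
      (if a.mark then n + 1 else n) (fun i => pos i + BitTape.shift (a.move i)) t K) :
    Spec l g O s inp n pos (t + 1) (fun o => K (o ++ a.emit.toList)) := by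
  simpa only [PMF.bind_const] using
    Spec.coin (fun _ => a) ha (fun _ => hm) hs (fun _ => h)

theorem spec_query (inp : List Bool) (n : ℕ) (pos : Fin (l.length + 1) → ℤ) :
    Spec l g O .query inp n pos 1 O := by
  intro o c hc
  have := OracleTM.Yields.ask (M := machine l g) (O := O) (c := c) hc.state
    (by simp [machine]) rfl rfl
  rwa [show (c.tape (machine l g).oracleTape).contents = o from hc.output.contents] at this

/-! ### Counting up to a polynomial with nested loops -/

/-- The number of ticks of a counting program on `n`: `true` is one tick, and `false` repeats the
rest of the program `n` times. -/
def ticks : List Bool → ℕ → ℕ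
  | [], _ => 0
  | true :: r, n => ticks r n + 1
  | false :: r, n => n * ticks r n

/-- Every polynomial is counted by some program, by Horner's rule. -/
theorem exists_ticks_eq (q : Polynomial ℕ) : ∃ l, ∀ n, ticks l n = q.eval n := by
  induction q using Polynomial.recOnHorner with
  | M0 => exact ⟨[], by simp [ticks]⟩
  | MC p a _ ha ih =>
    obtain ⟨l, hl⟩ := ih
    refine ⟨List.replicate a true ++ l, fun n => ?_⟩
    rw [Polynomial.eval_add, Polynomial.eval_C, ← hl]
    clear hl ha
    induction a with
    | zero => rfl
    | succ a iha =>
      rw [List.replicate_succ, List.cons_append, ticks, iha, add_assoc]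
  | MX p _ ih =>
    obtain ⟨l, hl⟩ := ih
    exact ⟨false :: l, fun n => by simp [ticks, hl, mul_comm]⟩

/-- The running time of a counting program. -/
noncomputable def time : List Bool → Polynomial ℕ
  | [] => 1
  | true :: r => time r + 2
  | false :: r => Polynomial.X * (time r + 2) + (Polynomial.X + 2)

/-- The effect of one tick on the distribution of the output: a random bit is appended to the
string on the oracle tape. -/
noncomputable def tick (g : Bool → Bool) (K : List Bool → PMF (List Bool)) (o : List Bool) :
    PMF (List Bool) :=
  (PMF.uniformOfFintype Bool).bind fun b => K (o ++ [g b])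

section Steps

variable {n p t : ℕ} {pos : Fin (l.length + 1) → ℤ} {K : List Bool → PMF (List Bool)}

theorem val_ix (hp : p ≤ l.length) : (ix l p).1 = p :=
  Nat.mod_eq_of_lt (Nat.lt_succ_of_le hp)

theorem shift_update (pos : Fin (l.length + 1) → ℤ) (i : Fin (l.length + 1))
    (d : Option Turing.Dir) :
    (fun j => pos j + BitTape.shift
      ((Function.update (fun _ => none) i d : Fin (l.length + 1) → Option Turing.Dir) j)) =
      Function.update pos i (pos i + BitTape.shift d) := by
  funext j
  by_cases h : j = i
  · subst h; simp
  · simp [h, BitTape.shift]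

theorem Spec.fwd_nil (hp : p ≤ l.length) (hl : l[p]? = none)
    (h : Spec l g O (.back (ix l p)) [] n pos t K) :
    Spec l g O (.fwd (ix l p)) [] n pos (t + 1) K := by
  have := Spec.det (g := g) (O := O) (s := .fwd (ix l p)) (inp := []) (n := n) (pos := pos)
    (t := t) (K := K) { state := .back (ix l p) }
    (fun b => by simp only [action, val_ix hp, hl]) (by simp) (by simp)
    (by simpa [BitTape.shift] using h)
  simpa using this

theorem Spec.fwd_tick (hp : p ≤ l.length) (hl : l[p]? = some true)
    (h : Spec l g O (.fwd (ix l (p + 1))) [] n pos t K) :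
    Spec l g O (.fwd (ix l p)) [] n pos (t + 1) (tick g K) :=
  Spec.coin (g := g) (O := O) (s := .fwd (ix l p)) (inp := []) (n := n) (pos := pos)
    (t := t) (K := K) (fun b => { state := .fwd (ix l (p + 1)), emit := some (g b) })
    (fun b => by simp only [action, val_ix hp, hl]) (by simp) (by simp)
    (fun b => by simpa [BitTape.shift] using h)

theorem Spec.fwd_enter (hp : p ≤ l.length) (hl : l[p]? = some false)
    (hpos : 0 ≤ pos (ix l p) ∧ pos (ix l p) < n)
    (h : Spec l g O (.fwd (ix l (p + 1))) [] n
      (Function.update pos (ix l p) (pos (ix l p) - 1)) t K) :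
    Spec l g O (.fwd (ix l p)) [] n pos (t + 1) K := by
  have := Spec.det (g := g) (O := O) (s := .fwd (ix l p)) (inp := []) (n := n) (pos := pos)
    (t := t) (K := K) { state := .fwd (ix l (p + 1)),
                        move := Function.update (fun _ => none) (ix l p) (some Turing.Dir.left) }
    (fun b => by simp only [action, val_ix hp, hl, if_pos hpos]; simp) (by simp) (by simp)
    (by rw [shift_update]; simpa [BitTape.shift, ← sub_eq_add_neg] using h)
  simpa using this

theorem Spec.fwd_leave (hp : p ≤ l.length) (hl : l[p]? = some false)
    (hpos : pos (ix l p) = -1)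
    (h : Spec l g O (.rew (ix l p)) [] n (Function.update pos (ix l p) 0) t K) :
    Spec l g O (.fwd (ix l p)) [] n pos (t + 1) K := by
  have := Spec.det (g := g) (O := O) (s := .fwd (ix l p)) (inp := []) (n := n) (pos := pos)
    (t := t) (K := K) { state := .rew (ix l p),
                        move := Function.update (fun _ => none) (ix l p) (some Turing.Dir.right) }
    (fun b => by simp only [action, val_ix hp, hl, hpos]; simp) (by simp) (by simp)
    (by
      rw [shift_update]
      simpa only [BitTape.shift, hpos, neg_add_cancel, Bool.false_eq_true, if_false] using h)
  simpa using this

theorem Spec.rew_step (hpos : 0 ≤ pos (ix l p) ∧ pos (ix l p) < n)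
    (h : Spec l g O (.rew (ix l p)) [] n
      (Function.update pos (ix l p) (pos (ix l p) + 1)) t K) :
    Spec l g O (.rew (ix l p)) [] n pos (t + 1) K := by
  have := Spec.det (g := g) (O := O) (s := .rew (ix l p)) (inp := []) (n := n) (pos := pos)
    (t := t) (K := K) { state := .rew (ix l p),
                        move := Function.update (fun _ => none) (ix l p) (some Turing.Dir.right) }
    (fun b => by simp only [action, if_pos hpos]; simp) (by simp) (by simp)
    (by rw [shift_update]; simpa [BitTape.shift] using h)
  simpa using this

theorem Spec.rew_end (hpos : pos (ix l p) = n)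
    (h : Spec l g O (.back (ix l p)) [] n
      (Function.update pos (ix l p) (n - 1)) t K) :
    Spec l g O (.rew (ix l p)) [] n pos (t + 1) K := by
  have := Spec.det (g := g) (O := O) (s := .rew (ix l p)) (inp := []) (n := n) (pos := pos)
    (t := t) (K := K) { state := .back (ix l p),
                        move := Function.update (fun _ => none) (ix l p) (some Turing.Dir.left) }
    (fun b => by simp only [action, hpos]; simp) (by simp) (by simp)
    (by
      rw [shift_update]
      simpa only [BitTape.shift, hpos, ← sub_eq_add_neg, Bool.false_eq_true, if_false] using h)
  simpa using this

theorem Spec.back_tick (hp : p + 1 ≤ l.length) (hl : l[p]? = some true)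
    (h : Spec l g O (.back (ix l p)) [] n pos t K) :
    Spec l g O (.back (ix l (p + 1))) [] n pos (t + 1) K := by
  have := Spec.det (g := g) (O := O) (s := .back (ix l (p + 1))) (inp := []) (n := n) (pos := pos)
    (t := t) (K := K) { state := .back (ix l p) }
    (fun b => by simp only [action, val_ix hp, Nat.add_sub_cancel, hl]; simp) (by simp) (by simp)
    (by simpa [BitTape.shift] using h)
  simpa using this

theorem Spec.back_loop (hp : p + 1 ≤ l.length) (hl : l[p]? = some false)
    (h : Spec l g O (.fwd (ix l p)) [] n pos t K) :
    Spec l g O (.back (ix l (p + 1))) [] n pos (t + 1) K := by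
  have := Spec.det (g := g) (O := O) (s := .back (ix l (p + 1))) (inp := []) (n := n) (pos := pos)
    (t := t) (K := K) { state := .fwd (ix l p) }
    (fun b => by simp only [action, val_ix hp, Nat.add_sub_cancel, hl]; simp) (by simp) (by simp)
    (by simpa [BitTape.shift] using h)
  simpa using this

theorem Spec.back_zero (h : Spec l g O .query [] n pos t K) :
    Spec l g O (.back (ix l 0)) [] n pos (t + 1) K := by
  have := Spec.det (g := g) (O := O) (s := .back (ix l 0)) (inp := []) (n := n) (pos := pos)
    (t := t) (K := K) { state := .query }
    (fun b => by simp [action]) (by simp) (by simp)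
    (by simpa [BitTape.shift] using h)
  simpa using this

/-- Rewinding a counter whose head is `j` cells short of the blank to the right of its block. -/
theorem Spec.rew (hfull : pos (ix l p) = n - 1)
    (h : Spec l g O (.back (ix l p)) [] n pos t K) (j : ℕ) (hj : j ≤ n) :
    Spec l g O (.rew (ix l p)) [] n (Function.update pos (ix l p) (n - j)) (t + 1 + j) K := by
  induction j with
  | zero =>
    refine Spec.rew_end (by simp) ?_
    rwa [Function.update_idem, ← hfull, Function.update_eq_self]
  | succ j ih =>
    refine Spec.rew_step (by simp; omega) ?_
    rw [Function.update_idem, Function.update_self]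
    have hk : ((n : ℤ) - (j + 1 : ℕ) + 1) = n - j := by push_cast; ring
    rw [hk]
    exact ih (by omega)

end Steps

/-- The counting program, started at instruction `p` with its counters at the right end, makes its
ticks and returns, leaving all counters as they were. -/
theorem Spec.run_program {n : ℕ} (r : List Bool) (p : ℕ) (hp : p ≤ l.length) (hr : l.drop p = r)
    (pos : Fin (l.length + 1) → ℤ) (hpos : ∀ j, p ≤ j.1 → pos j = n - 1) (t : ℕ)
    (K : List Bool → PMF (List Bool)) (h : Spec l g O (.back (ix l p)) [] n pos t K) :
    Spec l g O (.fwd (ix l p)) [] n pos (t + (time r).eval n) ((tick g)^[ticks r n] K) := by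
  induction r generalizing p pos t K with
  | nil =>
    have hl : l[p]? = none := by
      rw [List.getElem?_eq_none_iff]
      exact List.drop_eq_nil_iff.1 hr
    simpa [time, ticks] using h.fwd_nil hp hl
  | cons a r ih =>
    have hl : l[p]? = some a := by
      rw [← List.head?_drop, hr, List.head?_cons]
    have hp1 : p + 1 ≤ l.length := by
      obtain ⟨h1, -⟩ := List.getElem?_eq_some_iff.1 hl
      exact h1
    have hr1 : l.drop (p + 1) = r := by
      rw [← List.tail_drop, hr, List.tail_cons]
    cases a with
    | true =>
      have h1 := ih (p + 1) hp1 hr1 pos (fun j hj => hpos j (by omega)) _ _ (h.back_tick hp1 hl)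
      have h2 := h1.fwd_tick hp hl
      rw [ticks, Function.iterate_succ_apply']
      convert h2 using 1
      simp [time]
      ring
    | false =>
      have hfull : pos (ix l p) = n - 1 := hpos _ (val_ix hp).ge
      -- The loop with its counter at position `k - 1` has `k` rounds left; at `-1` it is rewound.
      have key : ∀ k : ℕ, k ≤ n → Spec l g O (.fwd (ix l p)) [] n
          (Function.update pos (ix l p) (k - 1))
          (t + (k * ((time r).eval n + 2) + (n + 2))) ((tick g)^[k * ticks r n] K) := by
        intro k hk
        induction k with
        | zero =>
          have h1 := h.rew hfull n le_rfl
          have h2 : Spec l g O (.fwd (ix l p)) [] n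
            (Function.update pos (ix l p) ((0 : ℕ) - 1)) (t + 1 + n + 1) K := by
            refine Spec.fwd_leave hp hl (by simp) ?_
            rw [Function.update_idem]
            simpa using h1
          convert h2 using 1
          · ring
          · simp
        | succ k ihk =>
          have h1 := (ihk (by omega)).back_loop hp1 hl
          have h2 := ih (p + 1) hp1 hr1 _ (fun j hj => by
            rw [Function.update_of_ne, hpos j (by omega)]
            rintro rfl
            rw [val_ix hp] at hj
            omega) _ _ h1
          have h3 : Spec l g O (.fwd (ix l p)) [] n
              (Function.update pos (ix l p) ((k + 1 : ℕ) - 1)) _ _ :=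
            Spec.fwd_enter hp hl (by simp; omega) (by
              rw [Function.update_idem, Function.update_self]
              convert h2 using 2
              push_cast
              ring)
          rw [← Function.iterate_add_apply] at h3
          convert h3 using 1
          · ring
          · congr 2
            ring
      have := key n le_rfl
      rw [← hfull, Function.update_eq_self] at this
      simpa [time, ticks] using this

/-! ### Copying the input -/

/-- The copying phase writes the input in paired form and makes each counter as long as the input.
-/
theorem Spec.copy {n : ℕ} (inp : List Bool) (t : ℕ) (K : List Bool → PMF (List Bool))
    (h : Spec l g O (.fwd (ix l 0)) [] (n + inp.length)
      (fun _ => ((n + inp.length : ℕ) : ℤ) - 1) t K) :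
    Spec l g O .copyFst inp n (fun _ => n) (t + 2 + 2 * inp.length)
      (fun o => K (o ++ pairStr inp [])) := by
  induction inp generalizing n with
  | nil =>
    have h1 := Spec.det (g := g) (O := O) (s := .sep) (inp := []) (n := n)
      (pos := fun _ => (n : ℤ)) (t := t) (K := K)
      { state := .fwd (ix l 0), emit := some true, move := fun _ => some Turing.Dir.left }
      (fun b => rfl) (by simp) (by simp)
      (by simpa [BitTape.shift, ← sub_eq_add_neg] using h)
    have h2 := Spec.det (g := g) (O := O) (s := .copyFst) (inp := []) (n := n)
      (pos := fun _ => (n : ℤ)) { state := .sep, emit := some false }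
      (fun b => rfl) (by simp) (by simp)
      (by simpa [BitTape.shift] using h1)
    simpa [pairStr] using h2
  | cons a inp ih =>
    have h0 := ih (n := n + 1) (by
      rw [List.length_cons] at h
      rwa [Nat.add_assoc, Nat.add_comm 1])
    have h1 := Spec.det (g := g) (O := O) (s := .copySnd) (inp := a :: inp) (n := n)
      (pos := fun _ => (n : ℤ))
      { state := .copyFst, emit := some a, advance := true, mark := true,
        move := fun _ => some Turing.Dir.right }
      (fun b => rfl) (by simp) (by simp)
      (by simpa [BitTape.shift] using h0)
    have h2 := Spec.det (g := g) (O := O) (s := .copyFst) (inp := a :: inp) (n := n)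
      (pos := fun _ => (n : ℤ)) { state := .copySnd, emit := some a }
      (fun b => rfl) (by simp) (by simp)
      (by simpa [BitTape.shift] using h1)
    convert h2 using 1
    · rw [List.length_cons]
      ring
    · funext o
      simp [pairStr]

/-! ### The output distribution of the machine -/

/-- `n` ticks append `n` independent relabelled coins. -/
theorem iterate_tick (g : Bool → Bool) (n : ℕ) (K : List Bool → PMF (List Bool)) (o : List Bool) :
    (tick g)^[n] K o = (uniformBits n).bind fun r => K (o ++ r.map g) := by
  induction n generalizing o with
  | zero =>
    have : uniformBits 0 = PMF.pure [] := by
      ext y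
      simp [uniformBits_apply, PMF.pure_apply]
    simp [this]
  | succ n ih =>
    rw [Function.iterate_succ_apply', tick, uniformBits_succ, PMF.bind_bind]
    congr 1
    funext b
    rw [ih, PMF.bind_map]
    simp [Function.comp_def]

/-- For each polynomial `q` some polynomial-time machine submits, on input `w`, the query
`⟨w, r⟩` and outputs the answer, where `r` consists of `q(|w|)` coins, relabelled by `g`. -/
theorem exists_queryMachine (q : Polynomial ℕ) (g : Bool → Bool) :
    ∃ (M : OracleTM) (T : Polynomial ℕ), ∀ (O : Oracle) (w : List Bool),
      M.HaltsWithin O w (T.eval w.length) ∧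
      M.outputAt O w (T.eval w.length) =
        (uniformBits (q.eval w.length)).bind fun r => O (pairStr w (r.map g)) := by
  obtain ⟨l, hl⟩ := exists_ticks_eq q
  refine ⟨machine l g, 1 + 1 + time l + 2 + 2 * Polynomial.X, fun O w => ?_⟩
  have h1 := Spec.run_program (g := g) (n := w.length) l 0 (Nat.zero_le _) rfl
    (fun _ => (w.length : ℤ) - 1) (fun _ _ => rfl) _ O
    (Spec.back_zero (spec_query (O := O) [] w.length _))
  have h2 := Spec.copy (n := 0) w _ _ (by simpa only [zero_add] using h1) _ _ (matches_init w)
  have hT : (1 + 1 + time l + 2 + 2 * Polynomial.X : Polynomial ℕ).eval w.length =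
      1 + 1 + (time l).eval w.length + 2 + 2 * w.length := by simp
  rw [hT]
  refine ⟨h2.haltsWithin, ?_⟩
  refine h2.outputAt_eq.trans ?_
  beta_reduce
  rw [iterate_tick, hl]
  simp [pairStr]

end QueryMachine

/-! ### Reductions between searching and sampling -/

theorem IsUniversalPrefixMachine.inFBPP_of_solvesSampling
    {U : List Bool → List Bool →. List Bool} (hU : IsUniversalPrefixMachine U)
    {R : SearchProblem} {O : Oracle} (h : SolvesSampling O (hU.samplingProblem R)) :
    InFBPP O R := by
  obtain ⟨q, hq⟩ := h
  obtain ⟨M, T, hM⟩ := QueryMachine.exists_queryMachine q id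
  refine ⟨M, T, fun x k hk => ⟨(hM O _).1, ?_⟩⟩
  rw [(hM O _).2]
  refine one_sub_le_of_variationDist_le (Q := (hU.samplingProblem R).dist x) (fun y hy => ?_)
    (by simpa using hq x k hk)
  simp [hU.samplingProblem_dist, conditionedPrior, hy]

/-- The sampler asks `B` once, with error parameter `1/2`. The constant depends only on the length
of a description of `B` as a prefix machine. -/
theorem IsUniversalPrefixMachine.exists_approximate_sampler
    {U : List Bool → List Bool →. List Bool} (hU : IsUniversalPrefixMachine U) (B : PTM) :
    ∃ η : ℝ, 0 < η ∧ ∀ R : SearchProblem, B.SolvesSearch R →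
      ∃ (M : OracleTM) (T : Polynomial ℕ), ∀ O : Oracle, IsSamplerFor O B → ∀ x : List Bool,
        M.HaltsWithin O x (T.eval x.length) ∧
        variationDist (M.outputAt O x (T.eval x.length)) ((hU.samplingProblem R).dist x) ≤
          1 - η := by
  obtain ⟨m, hm⟩ := hU.exists_dominates B (zeros 2)
  -- Relabelling both coins by `0` turns two random bits into the unary error parameter `00`.
  obtain ⟨M, T, hM⟩ := QueryMachine.exists_queryMachine (Polynomial.C 2) fun _ => false
  refine ⟨(2⁻¹ ^ m * 2⁻¹ : ENNReal).toReal, ?_, fun R hR => ⟨M, T, fun O hO x => ⟨(hM O x).1, ?_⟩⟩⟩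
  · exact ENNReal.toReal_pos (by simp) (by finiteness)
  obtain ⟨hhalt, hsol⟩ := hR x 2 (by norm_num)
  have hout : M.outputAt O x (T.eval x.length) = O (pairStr x (zeros 2)) := by
    rw [(hM O x).2, Polynomial.eval_C]
    ext y
    rw [PMF.bind_apply]
    have hterm : ∀ r, uniformBits 2 r * O (pairStr x (r.map fun _ => false)) y =
        uniformBits 2 r * O (pairStr x (zeros 2)) y := fun r => by
      rw [uniformBits_apply]
      split_ifs with hr
      · rw [List.map_const', hr, zeros]
      · simp
    rw [tsum_congr hterm, ENNReal.tsum_mul_right, PMF.tsum_coe, one_mul]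
  rw [hout]
  refine variationDist_le_of_dominates (A := R.sol x) ?_ (fun y hy => ?_) ?_
  · exact pow_le_one₀ zero_le (by simp)
  · rw [hO _ hhalt, hU.samplingProblem_dist]
    exact (hm x y).trans (hU.universalPrior_le_conditionedPrior x hy)
  · rw [PMF.toOuterMeasure_apply, ← tsum_subtype]
    simp only [hO _ hhalt]
    refine le_trans ?_ hsol
    simp

theorem mainTheorem3
    (U : List Bool → List Bool →. List Bool) (hU : IsUniversalPrefixMachine U) :
    ∃ S : SearchProblem → SamplingProblem,
      (∀ (R : SearchProblem) (x y : List Bool),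
        (S R).dist x y = conditionedPrior U x (R.sol x) y) ∧
      (∀ (R : SearchProblem) (O : Oracle), SolvesSampling O (S R) → InFBPP O R) ∧
      (∀ B : PTM, ∃ η : ℝ, 0 < η ∧ ∀ R : SearchProblem, B.SolvesSearch R →
        ∃ (M : OracleTM) (T : Polynomial ℕ), ∀ O : Oracle, IsSamplerFor O B →
          ∀ x : List Bool,
            M.HaltsWithin O x (T.eval x.length) ∧
            variationDist (M.outputAt O x (T.eval x.length)) ((S R).dist x) ≤ 1 - η) :=
  ⟨hU.samplingProblem, hU.samplingProblem_dist, fun _ _ h => hU.inFBPP_of_solvesSampling h,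
    hU.exists_approximate_sampler⟩
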